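/- Let $1\le d<K$ and let $\Phi\in\mathbb R^{K\times d}$ have rows $\phi_1,\dots,\phi_K$ (the arms' features) with $\|\phi_i\|_2\le 1$ for all $i$ and $\lambda_{\min}\big(\sum_{i=1}^d\phi_i\phi_i^\top\big)\ge 1$. For $\alpha$ in the simplex $\Delta_K$ with $\Phi^\top\mathrm{diag}(\alpha)\Phi$ invertible and $\mu\in\mathbb R^K$, let $\mathbf P^{\alpha}(\mu)=\arg\min_\theta\sum_i\alpha_i(\phi_i^\top\theta-\mu_i)^2$. The robust observation region $\mathcal C_k$ is the set of all $\mu\in\mathbb R^K$ with $\mu_k>\mu_i$ for all $i\ne k$ such that, for every such $\alpha$, $\phi_k^\top\mathbf P^\alpha(\mu)>\phi_i^\top\mathbf P^\alpha(\mu)$ for all $i\neq k$. Call $\Delta>0$ a model-space gap of $\mu\in\mathcal C_k$ if $\phi_k^\top\mathbf P^\alpha(\mu)-\phi_i^\top\mathbf P^\alpha(\mu)\ge\Delta$ for all such $\alpha$ and all $i\ne k$. LinUCB (OFUL) with parameters $R>0$, $\delta>0$ first plays each of the arms $1,\dots,d$ once. Then, in rounds $t=1,2,\dots$, it lets $V_t$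 be the sum of $\phi\phi^\top$ and $S_t$ the sum of $\phi\,y$ over all previous plays (forced ones included; $\phi$ the feature played, $y$ the observed reward), puts $\hat\theta_t=V_t^{-1}S_t$, and plays an arm $A_t$ such that $(A_t,\tilde\theta_t)$ maximizes $\phi_i^\top\theta$ over $i\in[K]$ and $\|\theta-\hat\theta_t\|_{V_t}\le\sqrt{\beta_t(\delta)}$, where $\beta_t(\delta)=2R^2\log\big((1+t/d)^{d/2}/\delta\big)$. Each play of an arm $i$ yields the reward $\mu_i$ plus noise, and the noise $\eta$ of every play (forced ones included) is conditionally $R$-sub-Gaussian: $\mathbf E[e^{\lambda\eta}\mid\text{arms up to and including this play, previous noises}]\le e^{\lambda^2R^2/2}$ for all $\lambda\in\mathbb R$. Let $\mu$ be an interior point of $\mathcal C_k$ (so that $k=\mathrm{OPT}(\mu)$), and let $\Delta_{\max}=\max_i(\mu_k-\mu_i)$. Then LinUCB has regret $\widetilde O(d\sqrt T)$ on $\mu$ with high probability. Explicitly: (a) There is a model-space gap $\Delta_{\min}>0$ of $\mu$, depending only on $\Phi$ and $\mu$, such that for all $R>0$ and $\delta>0$ and all noise as above, with probability at least $1-\delta$,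 for all $t\ge1$, $$\sum_{s=1}^t\mathbb 1\{A_s\ne k\}\le\frac{4\sqrt t\,R}{\Delta_{\min}}\sqrt{\log\frac{(1+t/d)^{d/2}}{\delta}}\sqrt{\log(1+t/d)^d},\qquad \sum_{s=1}^t(\mu_k-\mu_{A_s})\le\frac{4\sqrt t\,R\,\Delta_{\max}}{\Delta_{\min}}\sqrt{\log\frac{(1+t/d)^{d/2}}{\delta}}\sqrt{\log(1+t/d)^d}.$$ (b) For every model-space gap $\Delta>0$ of $\mu$ and all $R,\delta>0$ there is $T_0$, depending only on $\Phi,\mu,\Delta,R,\delta$, such that for all noise as above, with probability at least $1-\delta$, both inequalities of (a), with $\Delta$ in place of $\Delta_{\min}$, hold for all $t\ge T_0$. -/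

import Mathlib

open MeasureTheory Matrix

noncomputable section

namespace MisspecifiedBandit

variable {K d : ℕ}

/-! ### Bandit instances, model estimates and robust regions

`Φ : Matrix (Fin K) (Fin d) ℝ` is the feature matrix, its row `Φ i` is the feature of arm `i`,
and `μ : Fin K → ℝ` is the vector of true mean rewards. -/

/-- Reward vectors for which arm `k` is the unique optimal arm. -/
def greedyRegion (k : Fin K) : Set (Fin K → ℝ) :=
  {μ | ∀ i, i ≠ k → μ i < μ k}

/-- Parameters `θ` with `Φ θ` in the `k`-th greedy region. -/
def robustParameterRegion (Φ : Matrix (Fin K) (Fin d) ℝ) (k : Fin K) : Set (Fin d → ℝ) :=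
  {θ | Φ *ᵥ θ ∈ greedyRegion k}

/-- The sampling distributions `α` in the simplex for which `Φᵀ diag(α) Φ` is invertible. -/
def samplingDistributions (Φ : Matrix (Fin K) (Fin d) ℝ) : Set (Fin K → ℝ) :=
  {α | α ∈ stdSimplex ℝ (Fin K) ∧ IsUnit (Φᵀ * Matrix.diagonal α * Φ)}

/-- `θ` is a model estimate of `μ` under the weights `α`: it minimizes the weighted
least-squares error `∑ i, α i * ((Φ θ) i - μ i) ^ 2`.
(It is unique when `Φᵀ diag(α) Φ` is invertible.) -/
def IsModelEstimate (Φ : Matrix (Fin K) (Fin d) ℝ) (α μ : Fin K → ℝ) (θ : Fin d → ℝ) : Prop :=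
  ∀ θ' : Fin d → ℝ,
    ∑ i, α i * ((Φ *ᵥ θ) i - μ i) ^ 2 ≤ ∑ i, α i * ((Φ *ᵥ θ') i - μ i) ^ 2

/-- Instances with optimal arm `k` all of whose model estimates lie in the `k`-th robust
parameter region. -/
def robustObservationRegion (Φ : Matrix (Fin K) (Fin d) ℝ) (k : Fin K) : Set (Fin K → ℝ) :=
  {μ | μ ∈ greedyRegion k ∧
    ∀ α ∈ samplingDistributions Φ, ∀ θ, IsModelEstimate Φ α μ θ → θ ∈ robustParameterRegion Φ k}

/-- `Δ` is a lower bound, over all sampling distributions, for the sub-optimality gaps of the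
arms `i ≠ k` in the model space. -/
def IsModelGap (Φ : Matrix (Fin K) (Fin d) ℝ) (μ : Fin K → ℝ) (k : Fin K) (Δ : ℝ) : Prop :=
  ∀ α ∈ samplingDistributions Φ, ∀ θ, IsModelEstimate Φ α μ θ →
    ∀ i, i ≠ k → Δ ≤ Φ k ⬝ᵥ θ - Φ i ⬝ᵥ θ

/-- The worst sub-optimality gap `max_i (μ_k - μ_i)`. -/
def maxGap (μ : Fin K → ℝ) (k : Fin K) : ℝ := ⨆ i, (μ k - μ i)

/-! ### The OFUL / LinUCB algorithm

Plays are indexed by `n = 0, 1, 2, …`. The plays `n < d` form the forced exploration phase;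
play `n = d + s` is round `t = s + 1` of the OFUL phase. -/

/-- The design matrix of the first `n` plays. -/
def designMatrix (Φ : Matrix (Fin K) (Fin d) ℝ) (a : ℕ → Fin K) (n : ℕ) :
    Matrix (Fin d) (Fin d) ℝ :=
  ∑ m ∈ Finset.range n, vecMulVec (Φ (a m)) (Φ (a m))

/-- The sum of the features of the first `n` plays weighted by the observed rewards `y`. -/
def responseVector (Φ : Matrix (Fin K) (Fin d) ℝ) (a : ℕ → Fin K) (y : ℕ → ℝ) (n : ℕ) :
    Fin d → ℝ :=
  ∑ m ∈ Finset.range n, y m • Φ (a m)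

/-- The least-squares estimate after `n` plays. -/
def lsEstimate (Φ : Matrix (Fin K) (Fin d) ℝ) (a : ℕ → Fin K) (y : ℕ → ℝ) (n : ℕ) :
    Fin d → ℝ :=
  (designMatrix Φ a n)⁻¹ *ᵥ responseVector Φ a y n

/-- `log ((1 + t/d)^(d/2) / δ)`. -/
def logTerm (d : ℕ) (δ : ℝ) (t : ℕ) : ℝ :=
  Real.log ((1 + (t : ℝ) / d) ^ ((d : ℝ) / 2) / δ)

/-- The squared confidence radius `β_t(δ) = 2 R² log ((1 + t/d)^(d/2) / δ)`. -/
def confidenceRadiusSq (d : ℕ) (R δ : ℝ) (t : ℕ) : ℝ :=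
  2 * R ^ 2 * logTerm d δ t

/-- The confidence ellipsoid used in round `s + 1` of the OFUL phase. -/
def confidenceSet (Φ : Matrix (Fin K) (Fin d) ℝ) (R δ : ℝ) (a : ℕ → Fin K) (y : ℕ → ℝ) (s : ℕ) :
    Set (Fin d → ℝ) :=
  {θ | √((θ - lsEstimate Φ a y (d + s)) ⬝ᵥ
        (designMatrix Φ a (d + s) *ᵥ (θ - lsEstimate Φ a y (d + s))))
      ≤ √(confidenceRadiusSq d R δ (s + 1))}

/-- The sequence of plays `a`, with observed rewards `y`, is produced by OFUL: the first `d` arms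
are played once each, and then every play maximizes `φ_i · θ` jointly over arms `i` and parameters
`θ` in the current confidence set (ties are broken in any way). -/
def FollowsOFUL (hdK : d ≤ K) (Φ : Matrix (Fin K) (Fin d) ℝ) (R δ : ℝ)
    (a : ℕ → Fin K) (y : ℕ → ℝ) : Prop :=
  (∀ i : Fin d, a i = Fin.castLE hdK i) ∧
  ∀ s : ℕ, ∃ θ ∈ confidenceSet Φ R δ a y s,
    ∀ j, ∀ θ' ∈ confidenceSet Φ R δ a y s, Φ j ⬝ᵥ θ' ≤ Φ (a (d + s)) ⬝ᵥ θ

/-- The design matrix `∑_{i ≤ d} φ_i φ_iᵀ` at the end of the forced exploration phase. -/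
def forcedDesign (hdK : d ≤ K) (Φ : Matrix (Fin K) (Fin d) ℝ) : Matrix (Fin d) (Fin d) ℝ :=
  ∑ i : Fin d, vecMulVec (Φ (Fin.castLE hdK i)) (Φ (Fin.castLE hdK i))

/-! ### The stochastic model -/

/-- The σ-algebra generated by the arms of the plays `0, …, n` and the noises of the plays
`0, …, n - 1`. -/
abbrev history {Ω : Type*} (A : ℕ → Ω → Fin K) (η : ℕ → Ω → ℝ) (n : ℕ) : MeasurableSpace Ω :=
  (⨆ m ∈ Set.Iic n, MeasurableSpace.comap (A m) inferInstance) ⊔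
    (⨆ m ∈ Set.Iio n, MeasurableSpace.comap (η m) inferInstance)

/-- A random run of OFUL on the instance `μ`: the reward of play `n` is `μ_{A_n} + η_n` with
conditionally `R`-sub-Gaussian noise `η_n`, and the arms are chosen by the algorithm. -/
structure IsOFULRun (hdK : d ≤ K) (Φ : Matrix (Fin K) (Fin d) ℝ) (μ : Fin K → ℝ) (R δ : ℝ)
    {Ω : Type*} [MeasurableSpace Ω] (P : Measure Ω)
    (A : ℕ → Ω → Fin K) (η : ℕ → Ω → ℝ) : Prop where
  measurable_arm : ∀ n, Measurable (A n)
  measurable_noise : ∀ n, Measurable (η n)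
  integrable_exp : ∀ n, ∀ l : ℝ, Integrable (fun ω => Real.exp (l * η n ω)) P
  subGaussian : ∀ n, ∀ l : ℝ,
    P[fun ω => Real.exp (l * η n ω) | history A η n] ≤ᵐ[P]
      fun _ => Real.exp (l ^ 2 * R ^ 2 / 2)
  follows : ∀ ω, FollowsOFUL hdK Φ R δ (fun n => A n ω) (fun n => μ (A n ω) + η n ω)

/-! ### Regret -/

/-- The number of plays of arms other than `k` in the first `t` rounds of the OFUL phase. -/
def suboptimalPlays (d : ℕ) (k : Fin K) (a : ℕ → Fin K) (t : ℕ) : ℝ :=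
  ∑ s ∈ Finset.range t, if a (d + s) ≠ k then (1 : ℝ) else 0

/-- The cumulative regret of the first `t` rounds of the OFUL phase. -/
def regret (d : ℕ) (μ : Fin K → ℝ) (k : Fin K) (a : ℕ → Fin K) (t : ℕ) : ℝ :=
  ∑ s ∈ Finset.range t, (μ k - μ (a (d + s)))

/-- `(4 √t R / Δ) √(log ((1 + t/d)^(d/2) / δ)) √(log ((1 + t/d)^d))`. -/
def playBound (d : ℕ) (R δ Δ : ℝ) (t : ℕ) : ℝ :=
  4 * √(t : ℝ) * R / Δ * √(logTerm d δ t) * √(Real.log ((1 + (t : ℝ) / d) ^ d))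

/-- `(4 √t R Δ_max / Δ) √(log ((1 + t/d)^(d/2) / δ)) √(log ((1 + t/d)^d))`. -/
def regretBound (d : ℕ) (R δ Δmax Δ : ℝ) (t : ℕ) : ℝ :=
  4 * √(t : ℝ) * R * Δmax / Δ * √(logTerm d δ t) * √(Real.log ((1 + (t : ℝ) / d) ^ d))

end MisspecifiedBandit

end

/-! The least-squares estimate is `θ₀ + V⁻¹ z`, where `z` is the noise-weighted sum of features and
`θ₀` is the estimate without noise. Up to scale `V` is the Gram matrix of the empirical play
frequencies, so `θ₀` is a model estimate of `μ` and has the model-space gap `Δ`, although `μ` need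
not be linear in the features (`lsEstimate_add`, `exists_samplingDistribution`). Interiority of `μ`
makes this gap uniform (`exists_isModelGap`).

Let `ρ` be the radius of the algorithm and suppose `‖z‖ ≤ r` in the `V⁻¹`-norm. By optimism
(`gap_le_of_optimistic`), playing `i ≠ k` forces `Δ ≤ (ρ + r) ‖φ_i‖ + (r - ρ) ‖φ_k‖` in that norm.
An arm played `N` times has `‖φ_i‖² ≤ 1 / N`. If the last term is at most `Δ / 2`, then `N` is of
order `(ρ + r)² / Δ²`. Mistakes are thus logarithmic in number, and the `√t` in the claim leaves
room to spare.

The proof does not need `r ≤ ρ` at all times. With `ℓ = log (1 / δ)`, Ville's inequality over a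
lattice of directions (`one_sub_le_measure_selfNormalized`) gives `r² = R² (2 ℓ + O(1 + log (1 + ℓ)
+ log log n))`. This is below `ρ²` once `t ≥ C₁ (1 + ℓ)^(3/2)`, which yields the eventual bound for
every gap. In earlier rounds the excess over `2 ℓ` is `O((1 + ℓ)^(1/4))`; then either the claimed
bound exceeds the number of rounds, or `R` is so small that the excess costs at most `Δ / 2`
(`radius_le_add_of_nontrivial`). All constants are absorbed by shrinking the gap to `Δmin`, which is
still a model-space gap. -/

namespace MisspecifiedBandit

open scoped ENNReal

/-! ### Supermartingale tools: Ville's inequality and conditional bounds. -/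

section Probability

variable {Ω : Type*} [m0 : MeasurableSpace Ω] {P : Measure Ω}

/-- Ville's maximal inequality for nonnegative supermartingales. -/
theorem mul_measure_exists_le_le {F : ℕ → MeasurableSpace Ω} (hF : ∀ n, F n ≤ m0)
    (hmono : Monotone F) {M : ℕ → Ω → ℝ≥0∞} (hM : ∀ n, Measurable[F n] (M n))
    (hstep : ∀ n s, MeasurableSet[F n] s → ∫⁻ ω in s, M (n + 1) ω ∂P ≤ ∫⁻ ω in s, M n ω ∂P)
    (h0 : ∫⁻ ω, M 0 ω ∂P ≤ 1) (c : ℝ≥0∞) :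
    c * P {ω | ∃ n, c ≤ M n ω} ≤ 1 := by
  set B : ℕ → Set Ω := fun n => {ω | ∀ m < n, M m ω < c} with hB
  have hlev : ∀ n, MeasurableSet[F n] {ω | M n ω < c} := fun n => hM n measurableSet_Iio
  have hBsucc : ∀ n, B (n + 1) = B n ∩ {ω | M n ω < c} := by
    intro n
    ext ω
    simp only [hB, Set.mem_ofPred_eq, Set.mem_inter_iff, Nat.lt_succ_iff_lt_or_eq]
    constructor
    · exact fun h => ⟨fun m hm => h m (Or.inl hm), h n (Or.inr rfl)⟩
    · rintro ⟨h1, h2⟩ m (hm | rfl)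
      exacts [h1 m hm, h2]
  have hBm' : ∀ n, MeasurableSet[F n] (B (n + 1)) := by
    intro n
    have : B (n + 1) = ⋂ m ∈ Set.Iic n, {ω | M m ω < c} := by
      ext ω; simp [hB]
    rw [this]
    refine MeasurableSet.biInter (Set.to_countable _) fun m hm => hmono hm _ (hlev m)
  have hBm : ∀ n, MeasurableSet (B n) := by
    intro n
    cases n with
    | zero => simp [hB]
    | succ n => exact hF n _ (hBm' n)
  -- The process is stopped at its first crossing of `c`; paths that have crossed are charged `c`
  -- each.
  have key : ∀ n, ∫⁻ ω in B n, M n ω ∂P + c * P (B n)ᶜ ≤ 1 := by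
    intro n
    induction n with
    | zero => simpa [hB] using h0
    | succ n ih =>
      refine le_trans ?_ ih
      have hd : B n \ {ω | M n ω < c} = B n ∩ {ω | c ≤ M n ω} := by
        ext ω; simp
      have hsplit : ∫⁻ ω in B (n + 1), M n ω ∂P + ∫⁻ ω in B n ∩ {ω | c ≤ M n ω}, M n ω ∂P
          = ∫⁻ ω in B n, M n ω ∂P := by
        rw [hBsucc, ← hd]
        exact lintegral_inter_add_sdiff _ _ (hF n _ (hlev n))
      have hcm : c * P (B n ∩ {ω | c ≤ M n ω}) ≤ ∫⁻ ω in B n ∩ {ω | c ≤ M n ω}, M n ω ∂P := by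
        rw [← setLIntegral_const]
        exact setLIntegral_mono' ((hBm n).inter (hF n _ (hM n measurableSet_Ici)))
          fun ω hω => hω.2
      have hcompl : (B (n + 1))ᶜ ⊆ (B n ∩ {ω | c ≤ M n ω}) ∪ (B n)ᶜ := by
        intro ω hω
        rw [hBsucc] at hω
        by_cases h : ω ∈ B n
        · exact Or.inl ⟨h, by simpa [h] using hω⟩
        · exact Or.inr h
      calc ∫⁻ ω in B (n + 1), M (n + 1) ω ∂P + c * P (B (n + 1))ᶜ
          ≤ ∫⁻ ω in B (n + 1), M n ω ∂P + c * (P (B n ∩ {ω | c ≤ M n ω}) + P (B n)ᶜ) := by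
            refine add_le_add (hstep n _ (hBm' n)) ?_
            gcongr
            exact (measure_mono hcompl).trans (measure_union_le _ _)
        _ ≤ ∫⁻ ω in B (n + 1), M n ω ∂P + (∫⁻ ω in B n ∩ {ω | c ≤ M n ω}, M n ω ∂P
              + c * P (B n)ᶜ) := by
            rw [mul_add]; gcongr
        _ = ∫⁻ ω in B n, M n ω ∂P + c * P (B n)ᶜ := by rw [← add_assoc, hsplit]
  have hU : {ω | ∃ n, c ≤ M n ω} = ⋃ n, (B n)ᶜ := by
    ext ω
    simp only [hB, Set.mem_ofPred_eq, Set.mem_iUnion, Set.mem_compl_iff, not_forall, not_lt]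
    exact ⟨fun ⟨n, h⟩ => ⟨n + 1, n, Nat.lt_succ_self n, h⟩, fun ⟨_, m, _, h⟩ => ⟨m, h⟩⟩
  have hmonoB : Monotone fun n => (B n)ᶜ := fun a b hab =>
    Set.compl_subset_compl.2 fun ω hω m hm => hω m (hm.trans_le hab)
  rw [hU, hmonoB.measure_iUnion, ENNReal.mul_iSup]
  exact iSup_le fun n => le_add_self.trans (key n)

/-- A conditional bound `E[f | m] ≤ c` tests against nonnegative `m`-measurable functions. -/
theorem lintegral_mul_le_of_condExp_le [IsFiniteMeasure P] {m : MeasurableSpace Ω} (hm : m ≤ m0)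
    {f : Ω → ℝ} (hf : Integrable f P) (hfm : Measurable[m0] f) (hf0 : ∀ ω, 0 ≤ f ω) {c : ℝ}
    (hc : P[f | m] ≤ᵐ[P] fun _ => c) {g : Ω → ℝ≥0∞} (hg : Measurable[m] g) :
    ∫⁻ ω, g ω * ENNReal.ofReal (f ω) ∂P ≤ ENNReal.ofReal c * ∫⁻ ω, g ω ∂P := by
  have hfe : Measurable[m0] fun ω => ENNReal.ofReal (f ω) := hfm.ennreal_ofReal
  -- Comparing measures on `m` before integrating `g` avoids any integrability condition on the
  -- product.
  have hle : (P.withDensity fun ω => ENNReal.ofReal (f ω)).trim hm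
      ≤ (ENNReal.ofReal c • P).trim hm := by
    refine @Measure.le_iff Ω m _ _ |>.2 fun s hs => ?_
    rw [trim_measurableSet_eq hm hs, trim_measurableSet_eq hm hs,
      withDensity_apply _ (hm s hs), ← ofReal_integral_eq_lintegral_ofReal hf.integrableOn
        (Filter.Eventually.of_forall hf0), ← setIntegral_condExp hm hf hs]
    simp only [Measure.smul_apply, smul_eq_mul]
    calc ENNReal.ofReal (∫ ω in s, (P[f | m]) ω ∂P)
        ≤ ENNReal.ofReal (∫ _ in s, c ∂P) := by
          refine ENNReal.ofReal_le_ofReal (integral_mono_ae integrable_condExp.integrableOn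
            (integrable_const c) (ae_restrict_of_ae hc))
      _ = ENNReal.ofReal c * P s := by
          rw [setIntegral_const, smul_eq_mul, ENNReal.ofReal_mul measureReal_nonneg, mul_comm]
          simp [Measure.real]
  have h := lintegral_mono' hle (le_refl g)
  rw [lintegral_trim hm hg, lintegral_trim hm hg, lintegral_smul_measure,
    lintegral_withDensity_eq_lintegral_mul _ hfe (hg.mono hm le_rfl)] at h
  simpa [mul_comm] using h

end Probability

variable {K d : ℕ}

/-! ### The exponential supermartingale of the noise. -/

theorem history_mono {Ω : Type*} (A : ℕ → Ω → Fin K) (η : ℕ → Ω → ℝ) : Monotone (history A η) := by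
  intro a b hab
  refine sup_le_sup ?_ ?_
  · exact biSup_mono fun m hm => le_trans hm hab
  · exact biSup_mono fun m hm => lt_of_lt_of_le hm hab

theorem measurable_arm_history {Ω : Type*} (A : ℕ → Ω → Fin K) (η : ℕ → Ω → ℝ) {m n : ℕ}
    (h : m ≤ n) : Measurable[history A η n] (A m) := by
  rw [measurable_iff_comap_le]
  exact le_sup_of_le_left (le_biSup (fun m => MeasurableSpace.comap (A m) inferInstance)
    (show m ∈ Set.Iic n from h))

theorem measurable_noise_history {Ω : Type*} (A : ℕ → Ω → Fin K) (η : ℕ → Ω → ℝ) {m n : ℕ}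
    (h : m < n) : Measurable[history A η n] (η m) := by
  rw [measurable_iff_comap_le]
  exact le_sup_of_le_right (le_biSup (fun m => MeasurableSpace.comap (η m) inferInstance)
    (show m ∈ Set.Iio n from h))

theorem history_le {Ω : Type*} [m0 : MeasurableSpace Ω] {A : ℕ → Ω → Fin K} {η : ℕ → Ω → ℝ}
    (hA : ∀ n, Measurable (A n)) (hη : ∀ n, Measurable (η n)) (n : ℕ) : history A η n ≤ m0 :=
  sup_le (iSup₂_le fun m _ => (hA m).comap_le) (iSup₂_le fun m _ => (hη m).comap_le)

/-- The log-likelihood ratio in which arm `i` is given the tilt `l i`. -/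
noncomputable def tiltExponent (R : ℝ) (l : Fin K → ℝ) (a : ℕ → Fin K) (e : ℕ → ℝ) (n : ℕ) : ℝ :=
  ∑ m ∈ Finset.range n, (l (a m) * e m - l (a m) ^ 2 * R ^ 2 / 2)

theorem measurable_tiltExponent {Ω : Type*} {A : ℕ → Ω → Fin K} {η : ℕ → Ω → ℝ}
    (R : ℝ) (l : Fin K → ℝ) (n : ℕ) :
    Measurable[history A η n] fun ω => tiltExponent R l (fun n => A n ω) (fun n => η n ω) n := by
  unfold tiltExponent
  refine Finset.measurable_sum _ fun m hm => ?_
  have hm' := Finset.mem_range.1 hm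
  have h1 : Measurable[history A η n] fun ω => l (A m ω) :=
    (measurable_of_finite l).comp (measurable_arm_history A η hm'.le)
  exact (h1.mul (measurable_noise_history A η hm')).sub (((h1.pow_const 2).mul_const _).div_const _)

/-- The exponential of the tilted exponent is a nonnegative supermartingale starting at 1, so
Ville's inequality applies with level `exp x`. -/
theorem measure_exists_tiltExponent_ge_le {Ω : Type*} [MeasurableSpace Ω] {P : Measure Ω}
    [IsProbabilityMeasure P] {hdK : d ≤ K} {Φ : Matrix (Fin K) (Fin d) ℝ} {μ : Fin K → ℝ}
    {R δ : ℝ} {A : ℕ → Ω → Fin K} {η : ℕ → Ω → ℝ} (h : IsOFULRun hdK Φ μ R δ P A η)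
    (l : Fin K → ℝ) (x : ℝ) :
    P {ω | ∃ n, x ≤ tiltExponent R l (fun n => A n ω) (fun n => η n ω) n}
      ≤ ENNReal.ofReal (Real.exp (-x)) := by
  have hle := history_le h.measurable_arm h.measurable_noise
  set M : ℕ → Ω → ℝ≥0∞ := fun n ω =>
    ENNReal.ofReal (Real.exp (tiltExponent R l (fun n => A n ω) (fun n => η n ω) n)) with hMdef
  have hM : ∀ n, Measurable[history A η n] (M n) := fun n =>
    (Real.measurable_exp.comp (measurable_tiltExponent R l n)).ennreal_ofReal
  have hstep : ∀ n s, MeasurableSet[history A η n] s →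
      ∫⁻ ω in s, M (n + 1) ω ∂P ≤ ∫⁻ ω in s, M n ω ∂P := by
    intro n s hs
    -- The sub-Gaussian bound is for deterministic tilts. As `A n` belongs to the history of play
    -- `n`, splitting over its value makes the tilt `l (A n)` constant on each piece.
    have hpart : ∀ f : Ω → ℝ≥0∞, Measurable f → ∫⁻ ω in s, f ω ∂P
        = ∑ i, ∫⁻ ω, (s ∩ A n ⁻¹' {i}).indicator f ω ∂P := by
      intro f hf
      rw [← lintegral_finsetSum _ fun i _ => hf.indicator
        ((hle n _ hs).inter (h.measurable_arm n (measurableSet_singleton i))),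
        ← lintegral_indicator (hle n _ hs)]
      refine lintegral_congr fun ω => ?_
      rw [Finset.sum_eq_single (A n ω)]
      · by_cases hω : ω ∈ s
        · rw [Set.indicator_of_mem hω, Set.indicator_of_mem
            (show ω ∈ s ∩ A n ⁻¹' {A n ω} from ⟨hω, rfl⟩)]
        · rw [Set.indicator_of_notMem hω, Set.indicator_of_notMem fun h => hω h.1]
      · exact fun i _ hi => Set.indicator_of_notMem (fun h => hi h.2.symm) _
      · exact fun h => absurd (Finset.mem_univ _) h
    rw [hpart _ ((hM (n + 1)).mono (hle _) le_rfl), hpart _ ((hM n).mono (hle _) le_rfl)]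
    refine Finset.sum_le_sum fun i _ => ?_
    have hset : MeasurableSet[history A η n] (s ∩ A n ⁻¹' {i}) :=
      hs.inter (measurable_arm_history A η le_rfl (measurableSet_singleton i))
    have hg : Measurable[history A η n] ((s ∩ A n ⁻¹' {i}).indicator (M n)) :=
      (hM n).indicator hset
    set r := l i ^ 2 * R ^ 2 / 2 with hr
    have hbd := lintegral_mul_le_of_condExp_le (hle n) (h.integrable_exp n (l i))
      (Real.measurable_exp.comp ((h.measurable_noise n).const_mul _))
      (fun ω => (Real.exp_pos _).le) (h.subGaussian n (l i)) hg
    have heq : ∀ ω, (s ∩ A n ⁻¹' {i}).indicator (M (n + 1)) ω = ENNReal.ofReal (Real.exp (-r)) *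
        ((s ∩ A n ⁻¹' {i}).indicator (M n) ω * ENNReal.ofReal (Real.exp (l i * η n ω))) := by
      intro ω
      by_cases hω : ω ∈ s ∩ A n ⁻¹' {i}
      · have hAi : A n ω = i := hω.2
        simp only [Set.indicator_of_mem hω, hMdef]
        rw [← ENNReal.ofReal_mul (Real.exp_pos _).le, ← ENNReal.ofReal_mul (Real.exp_pos _).le,
          ← Real.exp_add, ← Real.exp_add]
        simp only [tiltExponent, Finset.sum_range_succ, hAi]
        congr 2
        ring
      · simp [Set.indicator_of_notMem hω]
    simp_rw [heq]
    rw [lintegral_const_mul' _ _ ENNReal.ofReal_ne_top]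
    calc _ ≤ ENNReal.ofReal (Real.exp (-r)) * (ENNReal.ofReal (Real.exp r) *
          ∫⁻ ω, (s ∩ A n ⁻¹' {i}).indicator (M n) ω ∂P) := by gcongr
      _ = _ := by
        rw [← mul_assoc, ← ENNReal.ofReal_mul (Real.exp_pos _).le, ← Real.exp_add]
        simp
  have hv := mul_measure_exists_le_le (P := P) hle (history_mono A η) hM hstep
    (by simp [hMdef, tiltExponent]) (ENNReal.ofReal (Real.exp x))
  have hset : {ω | ∃ n, x ≤ tiltExponent R l (fun n => A n ω) (fun n => η n ω) n}
      = {ω | ∃ n, ENNReal.ofReal (Real.exp x) ≤ M n ω} := by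
    ext ω
    simp only [Set.mem_ofPred_eq, hMdef, ENNReal.ofReal_le_ofReal_iff (Real.exp_pos _).le,
      Real.exp_le_exp]
  rw [hset]
  calc _ = ENNReal.ofReal (Real.exp (-x)) * (ENNReal.ofReal (Real.exp x) *
        P {ω | ∃ n, ENNReal.ofReal (Real.exp x) ≤ M n ω}) := by
        rw [← mul_assoc, ← ENNReal.ofReal_mul (Real.exp_pos _).le, ← Real.exp_add]
        simp
    _ ≤ ENNReal.ofReal (Real.exp (-x)) * 1 := by gcongr
    _ = _ := mul_one _

/-! ### Cauchy–Schwarz for the norms of `V` and `V⁻¹`. -/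

section QuadraticForms

variable {V : Matrix (Fin d) (Fin d) ℝ}

theorem dotProduct_vecMulVec_mulVec (x u v : Fin d → ℝ) :
    u ⬝ᵥ (vecMulVec x x *ᵥ v) = (x ⬝ᵥ u) * (x ⬝ᵥ v) := by
  rw [vecMulVec_mulVec, dotProduct_smul, dotProduct_comm u x]
  simp

theorem dotProduct_mulVec_comm (hV : V.PosDef) (u v : Fin d → ℝ) :
    u ⬝ᵥ (V *ᵥ v) = v ⬝ᵥ (V *ᵥ u) := by
  have hT : Vᵀ = V := by simpa [conjTranspose_eq_transpose_of_trivial] using hV.isHermitian.eq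
  rw [dotProduct_comm u, ← vecMul_transpose, hT, dotProduct_mulVec]

theorem quadForm_nonneg (hV : V.PosDef) (v : Fin d → ℝ) : 0 ≤ v ⬝ᵥ (V *ᵥ v) := by
  simpa using hV.posSemidef.dotProduct_mulVec_nonneg v

theorem quadForm_pos (hV : V.PosDef) {v : Fin d → ℝ} (hv : v ≠ 0) : 0 < v ⬝ᵥ (V *ᵥ v) := by
  simpa using hV.dotProduct_mulVec_pos hv

theorem quadForm_add (hV : V.PosDef) (u v : Fin d → ℝ) :
    (u + v) ⬝ᵥ (V *ᵥ (u + v)) = u ⬝ᵥ (V *ᵥ u) + 2 * (u ⬝ᵥ (V *ᵥ v)) + v ⬝ᵥ (V *ᵥ v) := by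
  rw [mulVec_add, add_dotProduct, dotProduct_add, dotProduct_add, dotProduct_mulVec_comm hV v u]
  ring

theorem quadForm_smul (c : ℝ) (v : Fin d → ℝ) :
    (c • v) ⬝ᵥ (V *ᵥ (c • v)) = c ^ 2 * (v ⬝ᵥ (V *ᵥ v)) := by
  rw [mulVec_smul, smul_dotProduct, dotProduct_smul, smul_eq_mul, smul_eq_mul]
  ring

theorem sq_dotProduct_mulVec_le (hV : V.PosDef) (u v : Fin d → ℝ) :
    (u ⬝ᵥ (V *ᵥ v)) ^ 2 ≤ (u ⬝ᵥ (V *ᵥ u)) * (v ⬝ᵥ (V *ᵥ v)) := by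
  by_cases hv : v = 0
  · simp [hv]
  have ha := quadForm_pos hV hv
  have h := quadForm_nonneg hV ((v ⬝ᵥ (V *ᵥ v)) • u + (-(u ⬝ᵥ (V *ᵥ v))) • v)
  rw [quadForm_add hV, quadForm_smul, quadForm_smul, mulVec_smul, smul_dotProduct,
    dotProduct_smul, smul_eq_mul, smul_eq_mul] at h
  have h2 : 0 ≤ (v ⬝ᵥ (V *ᵥ v)) *
      ((u ⬝ᵥ (V *ᵥ u)) * (v ⬝ᵥ (V *ᵥ v)) - (u ⬝ᵥ (V *ᵥ v)) ^ 2) := by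
    nlinarith [h]
  linarith [nonneg_of_mul_nonneg_right h2 ha]

theorem mulVec_inv_mulVec (hV : V.PosDef) (x : Fin d → ℝ) : V *ᵥ (V⁻¹ *ᵥ x) = x := by
  rw [mulVec_mulVec, mul_nonsing_inv _ ((isUnit_iff_isUnit_det _).1 hV.isUnit), one_mulVec]

theorem quadForm_inv (hV : V.PosDef) (x : Fin d → ℝ) :
    (V⁻¹ *ᵥ x) ⬝ᵥ (V *ᵥ (V⁻¹ *ᵥ x)) = x ⬝ᵥ (V⁻¹ *ᵥ x) := by
  rw [mulVec_inv_mulVec hV, dotProduct_comm]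

theorem quadForm_inv_nonneg (hV : V.PosDef) (x : Fin d → ℝ) : 0 ≤ x ⬝ᵥ (V⁻¹ *ᵥ x) := by
  rw [← quadForm_inv hV]
  exact quadForm_nonneg hV _

theorem dotProduct_eq_inv_mulVec (hV : V.PosDef) (x v : Fin d → ℝ) :
    x ⬝ᵥ v = (V⁻¹ *ᵥ x) ⬝ᵥ (V *ᵥ v) := by
  rw [dotProduct_mulVec_comm hV, mulVec_inv_mulVec hV, dotProduct_comm]

theorem sq_dotProduct_le (hV : V.PosDef) (x v : Fin d → ℝ) :
    (x ⬝ᵥ v) ^ 2 ≤ (x ⬝ᵥ (V⁻¹ *ᵥ x)) * (v ⬝ᵥ (V *ᵥ v)) := by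
  rw [dotProduct_eq_inv_mulVec hV, ← quadForm_inv hV x]
  exact sq_dotProduct_mulVec_le hV _ _

theorem abs_dotProduct_le (hV : V.PosDef) (x v : Fin d → ℝ) :
    |x ⬝ᵥ v| ≤ √(x ⬝ᵥ (V⁻¹ *ᵥ x)) * √(v ⬝ᵥ (V *ᵥ v)) := by
  rw [← Real.sqrt_mul (quadForm_inv_nonneg hV x)]
  exact Real.abs_le_sqrt (sq_dotProduct_le hV x v)

theorem abs_dotProduct_inv_le (hV : V.PosDef) (x z : Fin d → ℝ) :
    |x ⬝ᵥ (V⁻¹ *ᵥ z)| ≤ √(x ⬝ᵥ (V⁻¹ *ᵥ x)) * √(z ⬝ᵥ (V⁻¹ *ᵥ z)) := by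
  have := abs_dotProduct_le hV x (V⁻¹ *ᵥ z)
  rwa [quadForm_inv hV] at this

/-- If `c x xᵀ ≤ V` then `xᵀ V⁻¹ x ≤ 1 / c`. -/
theorem mul_inv_quadForm_le_one (hV : V.PosDef) {c : ℝ} {x : Fin d → ℝ}
    (h : ∀ v, c * (x ⬝ᵥ v) ^ 2 ≤ v ⬝ᵥ (V *ᵥ v)) : c * (x ⬝ᵥ (V⁻¹ *ᵥ x)) ≤ 1 := by
  have h1 := h (V⁻¹ *ᵥ x)
  rw [quadForm_inv hV] at h1
  rcases (quadForm_inv_nonneg hV x).eq_or_lt with h0 | h0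
  · rw [← h0]; simp
  · nlinarith

theorem sqrt_quadForm_add_le (hV : V.PosDef) (u v : Fin d → ℝ) :
    √((u + v) ⬝ᵥ (V *ᵥ (u + v))) ≤ √(u ⬝ᵥ (V *ᵥ u)) + √(v ⬝ᵥ (V *ᵥ v)) := by
  rw [Real.sqrt_le_left (by positivity), quadForm_add hV, add_sq,
    Real.sq_sqrt (quadForm_nonneg hV u), Real.sq_sqrt (quadForm_nonneg hV v), mul_assoc,
    ← Real.sqrt_mul (quadForm_nonneg hV u)]
  gcongr
  exact Real.le_sqrt_of_sq_le (sq_dotProduct_mulVec_le hV u v)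

end QuadraticForms

/-! ### Optimism and lattice rounding for a fixed design matrix. -/

/-- If the maximizer of the linear form `φ ↦ φ · θ` over arms and over the ellipsoid of radius `r`
around the estimate `θ' + V⁻¹ z` is `x`, then `x` is nearly optimal for `θ'`. -/
theorem gap_le_of_optimistic {V : Matrix (Fin d) (Fin d) ℝ} (hV : V.PosDef) {r r' : ℝ} (hr : 0 ≤ r)
    {x y z θ₀ θ : Fin d → ℝ} (hz : √(z ⬝ᵥ (V⁻¹ *ᵥ z)) ≤ r')
    (hθ : √((θ - (θ₀ + V⁻¹ *ᵥ z)) ⬝ᵥ (V *ᵥ (θ - (θ₀ + V⁻¹ *ᵥ z)))) ≤ r)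
    (hmax : ∀ θ', √((θ' - (θ₀ + V⁻¹ *ᵥ z)) ⬝ᵥ (V *ᵥ (θ' - (θ₀ + V⁻¹ *ᵥ z)))) ≤ r →
      y ⬝ᵥ θ' ≤ x ⬝ᵥ θ) :
    y ⬝ᵥ θ₀ - x ⬝ᵥ θ₀ ≤
      (r + r') * √(x ⬝ᵥ (V⁻¹ *ᵥ x)) + (r' - r) * √(y ⬝ᵥ (V⁻¹ *ᵥ y)) := by
  set e := V⁻¹ *ᵥ z with he
  set Y := √(y ⬝ᵥ (V⁻¹ *ᵥ y)) with hY
  set X := √(x ⬝ᵥ (V⁻¹ *ᵥ x)) with hX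
  have hX0 : 0 ≤ X := Real.sqrt_nonneg _
  have hY0 : 0 ≤ Y := Real.sqrt_nonneg _
  have hYsq : Y ^ 2 = y ⬝ᵥ (V⁻¹ *ᵥ y) := Real.sq_sqrt (quadForm_inv_nonneg hV y)
  have hopt : y ⬝ᵥ (θ₀ + e) + r * Y ≤ x ⬝ᵥ θ := by
    -- This point maximizes `y` over the ellipsoid. If `Y = 0`, then `r / Y = 0` and it is the
    -- centre.
    have h := hmax ((θ₀ + e) + (r / Y) • (V⁻¹ *ᵥ y)) (by
      rw [add_sub_cancel_left, quadForm_smul, quadForm_inv hV, ← hYsq, ← mul_pow,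
        Real.sqrt_sq (by positivity)]
      rcases hY0.eq_or_lt with h0 | h0
      · rw [← h0]; simpa using hr
      · rw [div_mul_cancel₀ _ h0.ne'])
    rw [dotProduct_add, dotProduct_smul, ← hYsq, smul_eq_mul] at h
    convert h using 2
    rcases hY0.eq_or_lt with h0 | h0
    · rw [← h0]; simp
    · field_simp
  have h1 := abs_le.1 (abs_dotProduct_le hV x (θ - (θ₀ + e)))
  have h2 := abs_le.1 (abs_dotProduct_inv_le hV x z)
  have h3 := abs_le.1 (abs_dotProduct_inv_le hV y z)
  rw [dotProduct_sub, dotProduct_add] at h1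
  rw [dotProduct_add] at hopt
  have h4 : X * √((θ - (θ₀ + e)) ⬝ᵥ (V *ᵥ (θ - (θ₀ + e)))) ≤ X * r := by gcongr
  have h5 : X * √(z ⬝ᵥ (V⁻¹ *ᵥ z)) ≤ X * r' := by gcongr
  have h6 : Y * √(z ⬝ᵥ (V⁻¹ *ᵥ z)) ≤ Y * r' := by gcongr
  nlinarith [h1.2, h2.2, h3.1]

/-- A bound for the tilted exponent at all points of the lattice `R⁻¹ B⁻¹ ℤᵈ` in a large cube
bounds the self-normalized norm of `z`. -/
theorem selfNormalized_le_of_lattice {V B : Matrix (Fin d) (Fin d) ℝ} (hV : V.PosDef)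
    (hB : IsUnit B) {κ : ℝ} (hlow : ∀ v, (B *ᵥ v) ⬝ᵥ (B *ᵥ v) ≤ κ * (v ⬝ᵥ (V *ᵥ v)))
    (hup : ∀ v, v ⬝ᵥ (V *ᵥ v) ≤ 2 * ((B *ᵥ v) ⬝ᵥ (B *ᵥ v)))
    {R b : ℝ} (hR : 0 < R) (hb : 0 ≤ b) (hbd : (d : ℝ) / 2 ≤ b ^ 2) {M : ℕ}
    (hM : κ * b ^ 2 ≤ (M : ℝ) ^ 2) {z : Fin d → ℝ}
    (hlat : ∀ p : Fin d → ℤ, (∀ i, |p i| ≤ M) →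
      (R⁻¹ • (B⁻¹ *ᵥ fun i => (p i : ℝ))) ⬝ᵥ z - R ^ 2 / 2 *
        ((R⁻¹ • (B⁻¹ *ᵥ fun i => (p i : ℝ))) ⬝ᵥ (V *ᵥ (R⁻¹ • (B⁻¹ *ᵥ fun i => (p i : ℝ)))))
      < (b ^ 2 - d / 2) / 2) :
    √(z ⬝ᵥ (V⁻¹ *ᵥ z)) ≤ R * b := by
  by_contra! hcon
  set S := √(z ⬝ᵥ (V⁻¹ *ᵥ z)) with hS
  have hSsq : S ^ 2 = z ⬝ᵥ (V⁻¹ *ᵥ z) := Real.sq_sqrt (quadForm_inv_nonneg hV z)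
  have hS0 : 0 < S := lt_of_le_of_lt (by positivity) hcon
  set ν : Fin d → ℝ := (R ^ 2)⁻¹ • (V⁻¹ *ᵥ z) with hν
  have hνν : ν ⬝ᵥ (V *ᵥ ν) = S ^ 2 / R ^ 4 := by
    rw [hν, quadForm_smul, quadForm_inv hV, hSsq]
    field_simp
  -- Shrinking the maximizer `ν` of the exponent to `V`-norm `b / R` keeps its rounding inside the
  -- cube, however large `z` is.
  set c := R * b / S with hc
  have hc0 : 0 ≤ c := by positivity
  have hc1 : c ≤ 1 := (div_le_one hS0).2 hcon.le
  set y : Fin d → ℝ := R • (B *ᵥ (c • ν)) with hy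
  have hyy : y ⬝ᵥ y ≤ (M : ℝ) ^ 2 := by
    refine le_trans ?_ hM
    have h1 := hlow (c • ν)
    rw [quadForm_smul, hνν] at h1
    rw [hy, smul_dotProduct, dotProduct_smul, smul_eq_mul, smul_eq_mul]
    calc R * (R * _) = R ^ 2 * ((B *ᵥ (c • ν)) ⬝ᵥ (B *ᵥ (c • ν))) := by ring
      _ ≤ R ^ 2 * (κ * (c ^ 2 * (S ^ 2 / R ^ 4))) := by gcongr
      _ = κ * b ^ 2 := by rw [hc]; field_simp
  have hyM : ∀ i, |y i| ≤ M := by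
    intro i
    refine abs_le_of_sq_le_sq (b := (M : ℝ)) (le_trans ?_ hyy) (Nat.cast_nonneg M)
    rw [dotProduct, pow_two]
    exact Finset.single_le_sum (f := fun i => y i * y i) (fun j _ => mul_self_nonneg _)
      (Finset.mem_univ i)
  set p : Fin d → ℤ := fun i => round (y i) with hp
  have hpM : ∀ i, |p i| ≤ M := by
    intro i
    have h := abs_le.1 (hyM i)
    have h' := abs_le.1 (abs_sub_round (y i))
    have h1 : ((p i : ℤ) : ℝ) < (M : ℤ) + 1 := by push_cast; linarith [h'.1]
    have h2 : -((M : ℤ) : ℝ) - 1 < (p i : ℤ) := by push_cast; linarith [h'.2]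
    norm_cast at h1 h2
    rw [abs_le]
    constructor <;> omega
  set l : Fin d → ℝ := R⁻¹ • (B⁻¹ *ᵥ fun i => (p i : ℝ)) with hl
  set e : Fin d → ℝ := l - c • ν with he
  have hBe : B *ᵥ e = R⁻¹ • ((fun i => (p i : ℝ)) - y) := by
    rw [he, mulVec_sub, hl, mulVec_smul, mulVec_mulVec,
      mul_nonsing_inv _ ((isUnit_iff_isUnit_det _).1 hB), one_mulVec, smul_sub, hy,
      inv_smul_smul₀ hR.ne']
  have hround : ((fun i => (p i : ℝ)) - y) ⬝ᵥ ((fun i => (p i : ℝ)) - y) ≤ d / 4 := by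
    rw [dotProduct]
    calc ∑ i, ((fun i => (p i : ℝ)) - y) i * ((fun i => (p i : ℝ)) - y) i
        ≤ ∑ _i : Fin d, (1 / 4 : ℝ) := by
          refine Finset.sum_le_sum fun i _ => ?_
          have h := abs_le.1 (abs_sub_round (y i))
          simp only [Pi.sub_apply, hp]
          nlinarith [h.1, h.2]
      _ = d / 4 := by simp; ring
  -- Rounding errs by at most 1/2 per coordinate, hence `d / 4` in square; `hup` doubles it.
  have hee : R ^ 2 * (e ⬝ᵥ (V *ᵥ e)) ≤ d / 2 := by
    have h1 := hup e
    rw [hBe, smul_dotProduct, dotProduct_smul, smul_eq_mul, smul_eq_mul] at h1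
    calc R ^ 2 * (e ⬝ᵥ (V *ᵥ e)) ≤ R ^ 2 * (2 * (R⁻¹ * (R⁻¹ *
          (((fun i => (p i : ℝ)) - y) ⬝ᵥ ((fun i => (p i : ℝ)) - y))))) := by gcongr
      _ = 2 * (((fun i => (p i : ℝ)) - y) ⬝ᵥ ((fun i => (p i : ℝ)) - y)) := by field_simp
      _ ≤ d / 2 := by linarith
  have hf := hlat p hpM
  rw [← hl] at hf
  -- Completing the square around `ν`.
  have hid : l ⬝ᵥ z - R ^ 2 / 2 * (l ⬝ᵥ (V *ᵥ l)) =
      (S / R) ^ 2 / 2 - R ^ 2 / 2 * ((l - ν) ⬝ᵥ (V *ᵥ (l - ν))) := by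
    have h1 : (l - ν) ⬝ᵥ (V *ᵥ (l - ν)) =
        l ⬝ᵥ (V *ᵥ l) - 2 * (l ⬝ᵥ (V *ᵥ ν)) + ν ⬝ᵥ (V *ᵥ ν) := by
      have := quadForm_add hV l (-ν)
      rw [mulVec_neg, dotProduct_neg, neg_dotProduct, dotProduct_neg, neg_neg] at this
      rw [sub_eq_add_neg, this]; ring
    have h2 : l ⬝ᵥ (V *ᵥ ν) = (R ^ 2)⁻¹ * (l ⬝ᵥ z) := by
      rw [hν, mulVec_smul, mulVec_inv_mulVec hV, dotProduct_smul, smul_eq_mul]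
    rw [h1, h2, hνν]
    field_simp
    ring
  have htri : R * √((l - ν) ⬝ᵥ (V *ᵥ (l - ν))) ≤ √(d / 2) + (S / R - b) := by
    have h1 : l - ν = e + (c - 1) • ν := by rw [he, sub_smul, one_smul]; abel
    have h2 := sqrt_quadForm_add_le hV e ((c - 1) • ν)
    rw [← h1, quadForm_smul, hνν] at h2
    have h3 : R * √(e ⬝ᵥ (V *ᵥ e)) ≤ √(d / 2) := by
      refine Real.le_sqrt_of_sq_le ?_
      rwa [mul_pow, Real.sq_sqrt (quadForm_nonneg hV e)]
    have h4 : √((c - 1) ^ 2 * (S ^ 2 / R ^ 4)) = (1 - c) * (S / R ^ 2) := by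
      rw [← Real.sqrt_sq (show 0 ≤ (1 - c) * (S / R ^ 2) from
        mul_nonneg (by linarith) (by positivity))]
      congr 1
      field_simp
      ring
    rw [h4] at h2
    have h5 : R * ((1 - c) * (S / R ^ 2)) = S / R - b := by
      rw [hc]; field_simp
    calc R * √((l - ν) ⬝ᵥ (V *ᵥ (l - ν)))
        ≤ R * (√(e ⬝ᵥ (V *ᵥ e)) + (1 - c) * (S / R ^ 2)) := by gcongr
      _ ≤ _ := by rw [mul_add, h5]; linarith
  have hqb : b ≤ S / R := by rw [le_div_iff₀ hR]; linarith
  have hgb : √((d : ℝ) / 2) ≤ b := Real.sqrt_le_iff.2 ⟨hb, hbd⟩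
  have hg2 : √((d : ℝ) / 2) ^ 2 = d / 2 := Real.sq_sqrt (by positivity)
  have hg0 : 0 ≤ √((d : ℝ) / 2) := Real.sqrt_nonneg _
  have hlast : R ^ 2 * ((l - ν) ⬝ᵥ (V *ᵥ (l - ν))) ≤ (√(d / 2) + (S / R - b)) ^ 2 := by
    rw [← Real.sq_sqrt (quadForm_nonneg hV (l - ν)), ← mul_pow]
    gcongr
  rw [hid] at hf
  -- With `q = S / R` and `g = √(d / 2)`, the inequality `q² - (g + q - b)² ≥ b² - g²` amounts to
  -- `(b - g) (q - b) ≥ 0`, contradicting `hf`.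
  nlinarith [mul_nonneg (sub_nonneg.2 hgb) (sub_nonneg.2 hqb)]

/-! ### Design matrices as Gram matrices of play counts. -/

section Gram

/-- The weighted design matrix `∑ i, w i φ_i φ_iᵀ`. -/
def gram (Φ : Matrix (Fin K) (Fin d) ℝ) (w : Fin K → ℝ) : Matrix (Fin d) (Fin d) ℝ :=
  ∑ i, w i • vecMulVec (Φ i) (Φ i)

/-- The number of plays of arm `i` among the first `n` plays. -/
def playCount (a : ℕ → Fin K) (n : ℕ) (i : Fin K) : ℕ :=
  ((Finset.range n).filter fun m => a m = i).card

theorem dotProduct_gram_mulVec (Φ : Matrix (Fin K) (Fin d) ℝ) (w : Fin K → ℝ) (u v : Fin d → ℝ) :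
    u ⬝ᵥ (gram Φ w *ᵥ v) = ∑ i, w i * ((Φ i ⬝ᵥ u) * (Φ i ⬝ᵥ v)) := by
  simp only [gram, sum_mulVec, dotProduct_sum, smul_mulVec, dotProduct_smul,
    dotProduct_vecMulVec_mulVec, smul_eq_mul]

theorem quadForm_gram (Φ : Matrix (Fin K) (Fin d) ℝ) (w : Fin K → ℝ) (v : Fin d → ℝ) :
    v ⬝ᵥ (gram Φ w *ᵥ v) = ∑ i, w i * (Φ i ⬝ᵥ v) ^ 2 := by
  rw [dotProduct_gram_mulVec]
  exact Finset.sum_congr rfl fun i _ => by rw [pow_two]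

theorem gram_eq_mul (Φ : Matrix (Fin K) (Fin d) ℝ) (w : Fin K → ℝ) :
    Φᵀ * Matrix.diagonal w * Φ = gram Φ w := by
  ext p q
  rw [gram, Matrix.sum_apply, Matrix.mul_apply]
  refine Finset.sum_congr rfl fun i _ => ?_
  rw [Matrix.mul_diagonal, Matrix.smul_apply, vecMulVec_apply, transpose_apply, smul_eq_mul]
  ring

theorem gram_smul (Φ : Matrix (Fin K) (Fin d) ℝ) (c : ℝ) (w : Fin K → ℝ) :
    gram Φ (fun i => c * w i) = c • gram Φ w := by
  simp only [gram, mul_smul, Finset.smul_sum]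

theorem sum_range_comp_eq {M : Type*} [AddCommMonoid M] (a : ℕ → Fin K) (n : ℕ) (f : Fin K → M) :
    ∑ m ∈ Finset.range n, f (a m) = ∑ i, playCount a n i • f i := by
  rw [← Finset.sum_fiberwise (Finset.range n) a]
  refine Finset.sum_congr rfl fun i _ => ?_
  rw [playCount, ← Finset.sum_const]
  exact Finset.sum_congr rfl fun m hm => by rw [(Finset.mem_filter.1 hm).2]

theorem designMatrix_eq_gram (Φ : Matrix (Fin K) (Fin d) ℝ) (a : ℕ → Fin K) (n : ℕ) :
    designMatrix Φ a n = gram Φ fun i => (playCount a n i : ℝ) := by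
  rw [designMatrix, sum_range_comp_eq a n fun i => vecMulVec (Φ i) (Φ i), gram]
  exact Finset.sum_congr rfl fun i _ => (Nat.cast_smul_eq_nsmul ℝ _ _).symm

theorem quadForm_designMatrix (Φ : Matrix (Fin K) (Fin d) ℝ) (a : ℕ → Fin K) (n : ℕ)
    (v : Fin d → ℝ) :
    v ⬝ᵥ (designMatrix Φ a n *ᵥ v) = ∑ m ∈ Finset.range n, (Φ (a m) ⬝ᵥ v) ^ 2 := by
  rw [designMatrix_eq_gram, quadForm_gram, sum_range_comp_eq a n fun i => (Φ i ⬝ᵥ v) ^ 2]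
  simp

theorem playCount_succ (a : ℕ → Fin K) (n : ℕ) (i : Fin K) :
    playCount a (n + 1) i = playCount a n i + if a n = i then 1 else 0 := by
  simp only [playCount, Finset.card_filter, Finset.sum_range_succ]

theorem playCount_mono (a : ℕ → Fin K) (i : Fin K) : Monotone fun n => playCount a n i :=
  monotone_nat_of_le_succ fun n => by simp only [playCount_succ]; omega

theorem playCount_le (a : ℕ → Fin K) (n : ℕ) (i : Fin K) : playCount a n i ≤ n :=
  (Finset.card_filter_le _ _).trans (Finset.card_range n).le

theorem sum_playCount (a : ℕ → Fin K) (n : ℕ) : ∑ i, playCount a n i = n := by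
  have := sum_range_comp_eq a n fun _ => 1
  simpa using this.symm

/-- The features of the first `d` arms span with least eigenvalue at least one. -/
theorem dotProduct_self_le_quadForm_gram {hdK : d ≤ K} {Φ : Matrix (Fin K) (Fin d) ℝ}
    (hforced : (forcedDesign hdK Φ - 1).PosSemidef) {w : Fin K → ℝ} (hw : ∀ i, 0 ≤ w i)
    (hw1 : ∀ i : Fin d, 1 ≤ w (Fin.castLE hdK i)) (v : Fin d → ℝ) :
    v ⬝ᵥ v ≤ v ⬝ᵥ (gram Φ w *ᵥ v) := by
  have h1 := hforced.dotProduct_mulVec_nonneg v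
  simp only [star_trivial, sub_mulVec, dotProduct_sub, one_mulVec, forcedDesign, sum_mulVec,
    dotProduct_sum, dotProduct_vecMulVec_mulVec] at h1
  rw [quadForm_gram]
  calc v ⬝ᵥ v ≤ ∑ j : Fin d, (Φ (Fin.castLE hdK j) ⬝ᵥ v) * (Φ (Fin.castLE hdK j) ⬝ᵥ v) := by
        linarith
    _ ≤ ∑ j : Fin d, w (Fin.castLE hdK j) * (Φ (Fin.castLE hdK j) ⬝ᵥ v) ^ 2 := by
        refine Finset.sum_le_sum fun j _ => ?_
        rw [pow_two]
        exact le_mul_of_one_le_left (mul_self_nonneg _) (hw1 j)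
    _ = ∑ i ∈ Finset.univ.map (Fin.castLEEmb hdK), w i * (Φ i ⬝ᵥ v) ^ 2 := by
        rw [Finset.sum_map]; rfl
    _ ≤ _ := Finset.sum_le_sum_of_subset_of_nonneg (Finset.subset_univ _)
        fun i _ _ => mul_nonneg (hw i) (sq_nonneg _)

theorem gram_posDef {hdK : d ≤ K} {Φ : Matrix (Fin K) (Fin d) ℝ}
    (hforced : (forcedDesign hdK Φ - 1).PosSemidef) {w : Fin K → ℝ} (hw : ∀ i, 0 ≤ w i)
    (hw1 : ∀ i : Fin d, 1 ≤ w (Fin.castLE hdK i)) : (gram Φ w).PosDef := by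
  refine PosDef.of_dotProduct_mulVec_pos ?_ fun v hv => ?_
  · ext p q
    simp [gram, Matrix.sum_apply, vecMulVec_apply, mul_comm]
  · rw [star_trivial]
    refine lt_of_lt_of_le ?_ (dotProduct_self_le_quadForm_gram hforced hw hw1 v)
    exact lt_of_le_of_ne (Finset.sum_nonneg fun i _ => mul_self_nonneg _)
      fun h => hv (dotProduct_self_eq_zero.1 h.symm)

theorem one_le_playCount {hdK : d ≤ K} {a : ℕ → Fin K}
    (ha : ∀ i : Fin d, a i = Fin.castLE hdK i) {n : ℕ} (hn : d ≤ n) (i : Fin d) :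
    1 ≤ playCount a n (Fin.castLE hdK i) :=
  Finset.card_pos.2 ⟨i, by simp [ha]; omega⟩

theorem designMatrix_posDef {hdK : d ≤ K} {Φ : Matrix (Fin K) (Fin d) ℝ}
    (hforced : (forcedDesign hdK Φ - 1).PosSemidef) {a : ℕ → Fin K}
    (ha : ∀ i : Fin d, a i = Fin.castLE hdK i) {n : ℕ} (hn : d ≤ n) :
    (designMatrix Φ a n).PosDef := by
  rw [designMatrix_eq_gram]
  exact gram_posDef hforced (fun i => Nat.cast_nonneg _)
    fun i => by exact_mod_cast one_le_playCount ha hn i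

theorem dotProduct_self_le_quadForm_designMatrix {hdK : d ≤ K} {Φ : Matrix (Fin K) (Fin d) ℝ}
    (hforced : (forcedDesign hdK Φ - 1).PosSemidef) {a : ℕ → Fin K}
    (ha : ∀ i : Fin d, a i = Fin.castLE hdK i) {n : ℕ} (hn : d ≤ n) (v : Fin d → ℝ) :
    v ⬝ᵥ v ≤ v ⬝ᵥ (designMatrix Φ a n *ᵥ v) := by
  rw [designMatrix_eq_gram]
  exact dotProduct_self_le_quadForm_gram hforced (fun i => Nat.cast_nonneg _)
    (fun i => by exact_mod_cast one_le_playCount ha hn i) v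

theorem sq_dotProduct_le_of_norm_le_one {x : Fin d → ℝ} (hx : ‖WithLp.toLp 2 x‖ ≤ 1)
    (v : Fin d → ℝ) : (x ⬝ᵥ v) ^ 2 ≤ v ⬝ᵥ v := by
  have h1 : x ⬝ᵥ x ≤ 1 := by
    have h := pow_le_one₀ (n := 2) (norm_nonneg _) hx
    rw [EuclideanSpace.real_norm_sq_eq] at h
    simpa [dotProduct, pow_two] using h
  have h2 : (x ⬝ᵥ v) ^ 2 ≤ (x ⬝ᵥ x) * (v ⬝ᵥ v) := by
    simp only [dotProduct]
    simpa [pow_two] using Finset.sum_mul_sq_le_sq_mul_sq Finset.univ x v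
  have h3 : 0 ≤ v ⬝ᵥ v := Finset.sum_nonneg fun i _ => mul_self_nonneg _
  nlinarith

-- A square root of `V` makes its norm Euclidean, so that a pullback of `ℤᵈ` can serve as a net of
-- directions.
open scoped MatrixOrder in
theorem exists_isUnit_quadForm_eq {V : Matrix (Fin d) (Fin d) ℝ} (hV : V.PosDef) :
    ∃ B : Matrix (Fin d) (Fin d) ℝ, IsUnit B ∧
      ∀ v, (B *ᵥ v) ⬝ᵥ (B *ᵥ v) = v ⬝ᵥ (V *ᵥ v) := by
  obtain ⟨B, hB⟩ := CStarAlgebra.nonneg_iff_eq_star_mul_self.mp hV.posSemidef.nonneg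
  rw [star_eq_conjTranspose, conjTranspose_eq_transpose_of_trivial] at hB
  refine ⟨B, ?_, fun v => ?_⟩
  · have h := (isUnit_iff_isUnit_det _).1 hV.isUnit
    rw [hB, det_mul] at h
    exact (isUnit_iff_isUnit_det _).2 (isUnit_of_mul_isUnit_right h)
  · rw [hB, ← mulVec_mulVec, dotProduct_mulVec v, vecMul_transpose]

end Gram

/-! ### Self-normalized concentration by a union bound over lattices. -/

section Concentration

/-- The half-width of the cube of lattice points used at scale `J`. -/
noncomputable def gridRadius (K d : ℕ) (ℓ : ℝ) (J : ℕ) : ℕ :=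
  ⌈((1 + K) * (2 * K + 6 + 11 * d) : ℝ) * √(1 + ℓ + J)⌉₊

/-- The union-bound cost of the lattice points used at scale `J`. -/
noncomputable def gridCost (K d : ℕ) (ℓ : ℝ) (J : ℕ) : ℝ :=
  Real.log (((J + 1 : ℕ) * (J + 2 : ℕ)) *
    ((J + 1 : ℕ) ^ K * (2 * gridRadius K d ℓ J + 1 : ℕ) ^ d))

/-- The squared radius of the self-normalized confidence ellipsoid at scale `J`. -/
noncomputable def selfNormalizedRadiusSq (K d : ℕ) (ℓ : ℝ) (J : ℕ) : ℝ :=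
  2 * ℓ + 2 * gridCost K d ℓ J + d / 2

theorem gridCost_eq (K d : ℕ) (ℓ : ℝ) (J : ℕ) :
    gridCost K d ℓ J = (K + 1) * Real.log (J + 1) + Real.log (J + 2)
      + d * Real.log (2 * gridRadius K d ℓ J + 1) := by
  rw [gridCost, Real.log_mul (by positivity) (by positivity),
    Real.log_mul (by positivity) (by positivity), Real.log_mul (by positivity) (by positivity),
    Real.log_pow, Real.log_pow]
  push_cast
  ring

theorem gridCost_nonneg (K d : ℕ) (ℓ : ℝ) (J : ℕ) : 0 ≤ gridCost K d ℓ J := by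
  rw [gridCost_eq]
  have h1 := Real.log_nonneg (show (1 : ℝ) ≤ J + 1 by simp)
  have h2 := Real.log_nonneg (show (1 : ℝ) ≤ J + 2 by linarith [(Nat.cast_nonneg J : (0 : ℝ) ≤ J)])
  have h3 := Real.log_nonneg (show (1 : ℝ) ≤ 2 * gridRadius K d ℓ J + 1 by simp)
  positivity

theorem gridRadius_le (K d : ℕ) {ℓ : ℝ} (hℓ : 0 ≤ ℓ) (J : ℕ) :
    (2 * gridRadius K d ℓ J + 1 : ℝ) ≤
      (2 * ((1 + K) * (2 * K + 6 + 11 * d)) + 3) * √(1 + ℓ + J) := by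
  have h1 : (1 : ℝ) ≤ √(1 + ℓ + J) := Real.one_le_sqrt.2
    (by linarith [(Nat.cast_nonneg J : (0 : ℝ) ≤ J)])
  have h2 := (Nat.ceil_lt_add_one (show 0 ≤ ((1 + K) * (2 * K + 6 + 11 * d) : ℝ) *
    √(1 + ℓ + J) by positivity)).le
  rw [← gridRadius] at h2
  linarith

/-- The radius involves the logarithm of the cube size, and the cube must contain the radius. The
constant `c` closes this circle: `2 K + 6 + 7 d + 4 d c ≤ (2 K + 6 + 11 d) c`, because `c ≥ 1`. -/
theorem mul_selfNormalizedRadiusSq_le (K d : ℕ) {ℓ : ℝ} (hℓ : 0 ≤ ℓ) (J : ℕ) :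
    (1 + K) * selfNormalizedRadiusSq K d ℓ J ≤ (gridRadius K d ℓ J : ℝ) ^ 2 := by
  have hJ : (0 : ℝ) ≤ J := Nat.cast_nonneg J
  set y : ℝ := 1 + ℓ + J with hy
  have hy1 : 1 ≤ y := by linarith
  set c : ℝ := (1 + K) * (2 * K + 6 + 11 * d) with hc
  have hK : (0 : ℝ) ≤ K := Nat.cast_nonneg K
  have hd : (0 : ℝ) ≤ d := Nat.cast_nonneg d
  have hc1 : 1 ≤ c := by nlinarith
  have hM : c * √y ≤ gridRadius K d ℓ J := Nat.le_ceil _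
  have hsq : √y ^ 2 = y := Real.sq_sqrt (by linarith)
  have hM2 : c ^ 2 * y ≤ (gridRadius K d ℓ J : ℝ) ^ 2 := by
    rw [← hsq, ← mul_pow]
    gcongr
  refine le_trans ?_ hM2
  have hsy : √y ≤ y := by
    rw [Real.sqrt_le_left (by linarith)]; nlinarith
  have hl1 : Real.log (J + 1) ≤ y := by
    have := Real.log_le_sub_one_of_pos (show (0 : ℝ) < J + 1 by linarith); linarith
  have hl2 : Real.log (J + 2) ≤ y := by
    have := Real.log_le_sub_one_of_pos (show (0 : ℝ) < J + 2 by linarith); linarith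
  have hl3 : Real.log (2 * gridRadius K d ℓ J + 1) ≤ (2 * c + 3) * y := by
    have h1 := Real.log_le_sub_one_of_pos
      (show (0 : ℝ) < 2 * gridRadius K d ℓ J + 1 by positivity)
    have h2 := gridRadius_le K d hℓ J
    have h3 : (2 * c + 3) * √y ≤ (2 * c + 3) * y := by gcongr
    linarith
  have hcost : gridCost K d ℓ J ≤ (K + 2 + d * (2 * c + 3)) * y := by
    rw [gridCost_eq]
    have h1 : (K + 1) * Real.log (J + 1) ≤ (K + 1) * y := by gcongr
    have h2 : d * Real.log (2 * gridRadius K d ℓ J + 1) ≤ d * ((2 * c + 3) * y) := by gcongr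
    nlinarith
  calc (1 + K) * selfNormalizedRadiusSq K d ℓ J
      ≤ (1 + K) * (2 * y + 2 * ((K + 2 + d * (2 * c + 3)) * y) + d * y) := by
        rw [selfNormalizedRadiusSq]
        gcongr
        · linarith
        · nlinarith
    _ = (1 + K) * (2 * K + 6 + 7 * d + 4 * d * c) * y := by ring
    _ ≤ (1 + K) * ((2 * K + 6 + 11 * d) * c) * y := by gcongr; nlinarith
    _ = c ^ 2 * y := by rw [hc]; ring

/-- For tilts linear in the features, the exponent depends on the path only through `z` and `V`. -/
theorem tiltExponent_eq (Φ : Matrix (Fin K) (Fin d) ℝ) (R : ℝ) (v : Fin d → ℝ) (a : ℕ → Fin K)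
    (e : ℕ → ℝ) (n : ℕ) :
    tiltExponent R (fun i => Φ i ⬝ᵥ v) a e n =
      v ⬝ᵥ responseVector Φ a e n - R ^ 2 / 2 * (v ⬝ᵥ (designMatrix Φ a n *ᵥ v)) := by
  rw [quadForm_designMatrix, responseVector, dotProduct_sum, tiltExponent, Finset.mul_sum,
    ← Finset.sum_sub_distrib]
  refine Finset.sum_congr rfl fun m _ => ?_
  rw [dotProduct_smul, smul_eq_mul, dotProduct_comm v]
  ring

theorem tsum_inv_mul_le_one : ∑' J : ℕ, ENNReal.ofReal (1 / ((J + 1) * (J + 2))) ≤ 1 := by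
  refine ENNReal.tsum_le_of_sum_range_le fun n => ?_
  rw [← ENNReal.ofReal_sum_of_nonneg fun i _ => by positivity, ← ENNReal.ofReal_one]
  refine ENNReal.ofReal_le_ofReal ?_
  have : ∑ i ∈ Finset.range n, (1 / (((i : ℝ) + 1) * (i + 2))) = 1 - 1 / (n + 1) := by
    induction n with
    | zero => simp
    | succ n ih => rw [Finset.sum_range_succ, ih]; push_cast; field_simp; ring
  rw [this]
  have : (0 : ℝ) ≤ 1 / (n + 1) := by positivity
  linarith

/-- A self-normalized concentration inequality for finitely many features, whose radius exceeds
`2 R² log (1 / δ)` by terms of order `log log (1 / δ)` and `log log n` only. -/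
theorem one_sub_le_measure_selfNormalized {Ω : Type*} [MeasurableSpace Ω] {P : Measure Ω}
    [IsProbabilityMeasure P] {hdK : d ≤ K} {Φ : Matrix (Fin K) (Fin d) ℝ}
    (hbounded : ∀ i, ‖WithLp.toLp 2 (Φ i)‖ ≤ 1)
    (hforced : (forcedDesign hdK Φ - 1).PosSemidef) {μ : Fin K → ℝ}
    {R δ : ℝ} (hR : 0 < R) (hδ : 0 < δ) (hδ1 : δ < 1) {A : ℕ → Ω → Fin K} {η : ℕ → Ω → ℝ}
    (h : IsOFULRun hdK Φ μ R δ P A η) {S : Set Ω}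
    (hS : ∀ ω, (∀ n, d ≤ n → √(responseVector Φ (fun n => A n ω) (fun n => η n ω) n ⬝ᵥ
      ((designMatrix Φ (fun n => A n ω) n)⁻¹ *ᵥ
        responseVector Φ (fun n => A n ω) (fun n => η n ω) n)) ≤
        R * √(selfNormalizedRadiusSq K d (-Real.log δ) (Nat.log 2 (n + 1)))) → ω ∈ S) :
    1 - δ ≤ P.real S := by
  set ℓ := -Real.log δ with hℓ
  have hℓ0 : 0 ≤ ℓ := by linarith [Real.log_neg hδ hδ1]
  have hBex : ∀ s : Fin K → ℕ, ∃ B : Matrix (Fin d) (Fin d) ℝ, IsUnit B ∧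
      ∀ v, (B *ᵥ v) ⬝ᵥ (B *ᵥ v) = v ⬝ᵥ (gram Φ (fun i => (2 : ℝ) ^ s i) *ᵥ v) := fun s =>
    exists_isUnit_quadForm_eq (gram_posDef hforced (fun i => by positivity)
      fun i => one_le_pow₀ one_le_two)
  choose B hBu hBq using hBex
  set tilt : (Fin K → ℕ) × (Fin d → ℤ) → Fin d → ℝ := fun sp =>
    R⁻¹ • ((B sp.1)⁻¹ *ᵥ fun i => (sp.2 i : ℝ)) with htilt
  -- The random matrix `V` is replaced by the Gram matrix of play counts rounded to powers of 2. At
  -- times `n` with `Nat.log 2 (n + 1) = J` this leaves `(J + 1) ^ K` candidates, each with its own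
  -- lattice.
  set grid : ℕ → Finset ((Fin K → ℕ) × (Fin d → ℤ)) := fun J =>
    (Fintype.piFinset fun _ => Finset.range (J + 1)) ×ˢ
      (Fintype.piFinset fun _ => Finset.Icc (-(gridRadius K d ℓ J : ℤ)) (gridRadius K d ℓ J))
    with hgrid
  set bad : Set Ω := ⋃ J : ℕ, ⋃ sp ∈ grid J, {ω | ∃ n, ℓ + gridCost K d ℓ J ≤
    tiltExponent R (fun i => Φ i ⬝ᵥ tilt sp) (fun n => A n ω) (fun n => η n ω) n} with hbad
  have hcard : ∀ J, ((grid J).card : ℝ) =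
      (J + 1 : ℕ) ^ K * (2 * gridRadius K d ℓ J + 1 : ℕ) ^ d := by
    intro J
    have : (gridRadius K d ℓ J + 1 + gridRadius K d ℓ J : ℤ).toNat = 2 * gridRadius K d ℓ J + 1 := by
      omega
    simp [hgrid, Finset.card_product, Fintype.card_piFinset, this]
  have hPbad : P bad ≤ ENNReal.ofReal δ := by
    calc P bad ≤ ∑' J : ℕ, P (⋃ sp ∈ grid J, {ω | ∃ n, ℓ + gridCost K d ℓ J ≤
            tiltExponent R (fun i => Φ i ⬝ᵥ tilt sp) (fun n => A n ω) (fun n => η n ω) n}) :=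
          measure_iUnion_le _
      _ ≤ ∑' J : ℕ, ENNReal.ofReal δ * ENNReal.ofReal (1 / ((J + 1) * (J + 2))) := by
          refine ENNReal.tsum_le_tsum fun J => ?_
          refine (measure_biUnion_finset_le _ _).trans ?_
          refine (Finset.sum_le_sum fun sp _ =>
            measure_exists_tiltExponent_ge_le h _ _).trans ?_
          rw [Finset.sum_const, nsmul_eq_mul, ← ENNReal.ofReal_natCast,
            ← ENNReal.ofReal_mul (Nat.cast_nonneg _), ← ENNReal.ofReal_mul hδ.le]
          refine ENNReal.ofReal_le_ofReal (le_of_eq ?_)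
          have hexp : Real.exp (-ℓ) = δ := by rw [hℓ, neg_neg, Real.exp_log hδ]
          rw [neg_add, Real.exp_add, hexp, Real.exp_neg, gridCost,
            Real.exp_log (by positivity), hcard]
          push_cast
          field_simp
      _ = ENNReal.ofReal δ * ∑' J : ℕ, ENNReal.ofReal (1 / ((J + 1) * (J + 2))) :=
          ENNReal.tsum_mul_left
      _ ≤ ENNReal.ofReal δ * 1 := by gcongr; exact tsum_inv_mul_le_one
      _ = _ := mul_one _
  have hcover : ∀ ω, ω ∉ bad → ω ∈ S := by
    intro ω hω
    refine hS ω fun n hn => ?_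
    set a := fun n => A n ω with ha
    have hforce : ∀ i : Fin d, a i = Fin.castLE hdK i := (h.follows ω).1
    set J := Nat.log 2 (n + 1) with hJ
    set s : Fin K → ℕ := fun i => Nat.log 2 (playCount a n i + 1) with hs
    have hrad : 0 ≤ 2 * ℓ + 2 * gridCost K d ℓ J := by
      have := gridCost_nonneg K d ℓ J
      positivity
    have hradSq : √(selfNormalizedRadiusSq K d ℓ J) ^ 2 = 2 * ℓ + 2 * gridCost K d ℓ J + d / 2 :=
      Real.sq_sqrt (by rw [selfNormalizedRadiusSq]; positivity)
    have hlo : ∀ i, (2 : ℝ) ^ s i ≤ playCount a n i + 1 := fun i => by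
      exact_mod_cast Nat.pow_log_le_self 2 (Nat.succ_ne_zero _)
    have hhi : ∀ i, (playCount a n i : ℝ) ≤ 2 * 2 ^ s i := fun i => by
      have : playCount a n i + 1 < 2 ^ (s i + 1) := Nat.lt_pow_succ_log_self one_lt_two _
      rw [pow_succ] at this
      exact_mod_cast (show playCount a n i ≤ 2 * 2 ^ s i by omega)
    refine selfNormalized_le_of_lattice (designMatrix_posDef hforced hforce hn) (hBu s)
      (κ := 1 + K) (M := gridRadius K d ℓ J) ?_ ?_ hR (Real.sqrt_nonneg _) ?_ ?_ ?_
    · intro v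
      rw [hBq, quadForm_gram]
      have h1 := dotProduct_self_le_quadForm_designMatrix hforced hforce hn v
      calc ∑ i, (2 : ℝ) ^ s i * (Φ i ⬝ᵥ v) ^ 2
          ≤ ∑ i, ((playCount a n i : ℝ) * (Φ i ⬝ᵥ v) ^ 2 + v ⬝ᵥ v) := by
            refine Finset.sum_le_sum fun i _ => ?_
            have h2 := sq_dotProduct_le_of_norm_le_one (hbounded i) v
            nlinarith [mul_le_mul_of_nonneg_right (hlo i) (sq_nonneg (Φ i ⬝ᵥ v))]
        _ = v ⬝ᵥ (designMatrix Φ a n *ᵥ v) + K * (v ⬝ᵥ v) := by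
            rw [Finset.sum_add_distrib, designMatrix_eq_gram, quadForm_gram]
            simp
        _ ≤ _ := by
            have : (K : ℝ) * (v ⬝ᵥ v) ≤ K * (v ⬝ᵥ (designMatrix Φ a n *ᵥ v)) := by gcongr
            linarith
    · intro v
      rw [hBq, quadForm_gram, designMatrix_eq_gram, quadForm_gram, Finset.mul_sum]
      refine Finset.sum_le_sum fun i _ => ?_
      rw [← mul_assoc]
      exact mul_le_mul_of_nonneg_right (hhi i) (sq_nonneg _)
    · rw [hradSq]; linarith
    · rw [Real.sq_sqrt (by rw [selfNormalizedRadiusSq]; positivity)]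
      exact mul_selfNormalizedRadiusSq_le K d hℓ0 J
    · intro p hp
      have hmem : (s, p) ∈ grid J := by
        simp only [hgrid, Finset.mem_product, Fintype.mem_piFinset, Finset.mem_range,
          Finset.mem_Icc]
        refine ⟨fun i => Nat.lt_succ_of_le (Nat.log_mono_right ?_), fun i => abs_le.1 (hp i)⟩
        exact Nat.succ_le_succ (playCount_le a n i)
      have hnot : ¬ ∃ n, ℓ + gridCost K d ℓ J ≤
          tiltExponent R (fun i => Φ i ⬝ᵥ tilt (s, p)) a (fun n => η n ω) n := fun hex =>
        hω (Set.mem_iUnion.2 ⟨J, Set.mem_iUnion₂.2 ⟨(s, p), hmem, hex⟩⟩)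
      have hlt := lt_of_not_ge fun hge => hnot ⟨n, hge⟩
      rw [tiltExponent_eq] at hlt
      rw [hradSq]
      calc _ < ℓ + gridCost K d ℓ J := hlt
        _ = _ := by ring
  -- Subadditivity instead of complements: `S` need not be measurable.
  have huniv : (Set.univ : Set Ω) ⊆ S ∪ bad := fun ω _ => by
    by_cases hω : ω ∈ bad
    · exact Or.inr hω
    · exact Or.inl (hcover ω hω)
  have h1 : 1 ≤ P.real S + P.real bad := by
    calc (1 : ℝ) = P.real Set.univ := by simp
      _ ≤ P.real (S ∪ bad) := measureReal_mono huniv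
      _ ≤ _ := measureReal_union_le _ _
  have h2 : P.real bad ≤ δ := ENNReal.toReal_le_of_le_ofReal hδ.le hPbad
  linarith

end Concentration

/-! ### Comparison of the concentration radius with the algorithm's radius. -/

section RadiusGrowth

theorem half_le_mul_log_one_add_div (hd : 0 < d) {t : ℕ} (ht : 1 ≤ t) :
    1 / 2 ≤ d * Real.log (1 + t / d) := by
  have hd' : (1 : ℝ) ≤ d := by exact_mod_cast hd
  have ht' : (1 : ℝ) ≤ t := by exact_mod_cast ht
  have h := Real.one_sub_inv_le_log_of_pos (show (0 : ℝ) < 1 + 1 / d by positivity)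
  have h1 : Real.log (1 + 1 / d) ≤ Real.log (1 + t / d) :=
    Real.log_le_log (by positivity) (by gcongr)
  have h2 : 1 / 2 ≤ (d : ℝ) * (1 - (1 + 1 / (d : ℝ))⁻¹) := by
    have : (d : ℝ) * (1 - (1 + 1 / (d : ℝ))⁻¹) = d / (d + 1) := by field_simp; ring
    rw [this, div_le_div_iff₀ (by norm_num) (by positivity)]
    linarith
  calc (1 / 2 : ℝ) ≤ _ := h2
    _ ≤ _ := by gcongr; linarith

/-- The excess of the self-normalized radius over `2 ℓ` grows slowly. -/
theorem exists_selfNormalizedRadiusSq_le (K : ℕ) (hd : 0 < d) : ∃ C : ℝ, 0 ≤ C ∧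
    ∀ ℓ : ℝ, 0 ≤ ℓ → ∀ t : ℕ, 1 ≤ t → selfNormalizedRadiusSq K d ℓ (Nat.log 2 (d + t)) ≤
      2 * ℓ + d * Real.log (1 + ℓ) + d / 6 * Real.log (1 + t) + C := by
  have hd' : (1 : ℝ) ≤ d := by exact_mod_cast hd
  set m : ℝ := 2 * K + 4 + d with hm
  have hm0 : 0 < m := by positivity
  -- Slope of a linear upper bound for `log`, with `m q = d / 12`. As `J ≤ 2 log d + 2 log (1 + t)`,
  -- the coefficient of `log (1 + t)` becomes `d / 6`.
  set q : ℝ := d / (12 * m) with hq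
  have hq0 : 0 < q := by positivity
  set c : ℝ := 2 * ((1 + K) * (2 * K + 6 + 11 * d)) + 3 with hc
  have hc0 : 0 < c := by positivity
  set C : ℝ := 2 * d * Real.log c + d / 2 + d / 12 * (2 * Real.log d + 2) - m * Real.log q with hC
  refine ⟨max C 0, le_max_right _ _, fun ℓ hℓ t ht => ?_⟩
  have ht' : (1 : ℝ) ≤ t := by exact_mod_cast ht
  set J := Nat.log 2 (d + t) with hJ
  have hJ0 : (0 : ℝ) ≤ J := Nat.cast_nonneg J
  have hJle : (J : ℝ) ≤ 2 * Real.log d + 2 * Real.log (1 + t) := by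
    have h1 : (2 : ℝ) ^ J ≤ d * (1 + t) := by
      have : (2 : ℝ) ^ J ≤ d + t := by exact_mod_cast Nat.pow_log_le_self 2 (by omega)
      nlinarith
    have h2 := Real.log_le_log (by positivity) h1
    rw [Real.log_pow, Real.log_mul (by positivity) (by positivity)] at h2
    have h3 := Real.log_two_gt_d9
    nlinarith
  have hlogJ : m * Real.log (J + 2) ≤
      d / 12 * (2 * Real.log d + 2 * Real.log (1 + t) + 2) - m * Real.log q := by
    have h1 := Real.log_le_sub_one_of_pos (show 0 < q * (J + 2) by positivity)
    rw [Real.log_mul hq0.ne' (by positivity)] at h1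
    have h2 : m * (q * (J + 2)) = d / 12 * (J + 2) := by rw [hq]; field_simp
    have h3 : m * Real.log (J + 2) ≤ m * (q * (J + 2) - Real.log q) := by gcongr; linarith
    have h4 : d / 12 * (J + 2) ≤ d / 12 * (2 * Real.log d + 2 * Real.log (1 + t) + 2) := by gcongr
    linarith
  have hlogM : 2 * Real.log (2 * gridRadius K d ℓ J + 1) ≤
      2 * Real.log c + Real.log (1 + ℓ) + Real.log (J + 2) := by
    have h1 := Real.log_le_log (by positivity) (gridRadius_le K d hℓ J)
    rw [← hc, Real.log_mul hc0.ne' (by positivity), Real.log_sqrt (by positivity)] at h1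
    have h2 : Real.log (1 + ℓ + J) ≤ Real.log ((1 + ℓ) * (J + 2)) :=
      Real.log_le_log (by positivity) (by nlinarith)
    rw [Real.log_mul (by positivity) (by positivity)] at h2
    linarith
  have hlogJ1 : Real.log (J + 1) ≤ Real.log (J + 2) :=
    Real.log_le_log (by positivity) (by linarith)
  have h1 : (2 * K + 2) * Real.log (J + 1) ≤ (2 * K + 2) * Real.log (J + 2) := by gcongr
  have h2 : d * (2 * Real.log (2 * gridRadius K d ℓ J + 1)) ≤
      d * (2 * Real.log c + Real.log (1 + ℓ) + Real.log (J + 2)) := by gcongr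
  have h3 : selfNormalizedRadiusSq K d ℓ J ≤
      2 * ℓ + d * Real.log (1 + ℓ) + d / 6 * Real.log (1 + t) + C := by
    rw [selfNormalizedRadiusSq, gridCost_eq, hC]
    rw [hm] at hlogJ ⊢
    linarith
  linarith [le_max_left C 0]

/-- Comparison of the self-normalized radius with the radius `2 ℓ + d log (1 + t / d)`. -/
theorem exists_radius_constants (K : ℕ) (hd : 0 < d) : ∃ C₀ C₁ C₂ : ℝ, 1 ≤ C₀ ∧ 0 < C₁ ∧ 0 < C₂ ∧
    ∀ ℓ : ℝ, 0 ≤ ℓ → ∀ t : ℕ, 1 ≤ t →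
      (C₁ * ((1 + ℓ) * √(1 + ℓ)) ≤ t → selfNormalizedRadiusSq K d ℓ (Nat.log 2 (d + t)) ≤
        2 * ℓ + d * Real.log (1 + t / d)) ∧
      (t < C₁ * ((1 + ℓ) * √(1 + ℓ)) →
        (selfNormalizedRadiusSq K d ℓ (Nat.log 2 (d + t)) - 2 * ℓ) ^ 2 ≤ C₂ * √(1 + ℓ)) ∧
      selfNormalizedRadiusSq K d ℓ (Nat.log 2 (d + t)) ≤
        C₀ * (2 * ℓ + d * Real.log (1 + t / d)) := by
  obtain ⟨C, hC0, hC⟩ := exists_selfNormalizedRadiusSq_le K hd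
  have hd' : (1 : ℝ) ≤ d := by exact_mod_cast hd
  have hlogd : 0 ≤ Real.log d := Real.log_nonneg hd'
  -- From time `exp c * (1 + ℓ)^(3/2)` on, `d log (1 + ℓ)` is at most `(2/3) d (log (1 + t) - c)`.
  -- The `c` part pays for `C + d log d`, and `2/3 + 1/6 < 1` does the rest.
  set c : ℝ := 3 / 2 * (C / d + Real.log d) with hc
  have hcC : 2 / 3 * d * c = C + d * Real.log d := by rw [hc]; field_simp
  have hc0 : 0 ≤ c := by positivity
  set E : ℝ := 5 * d + d / 6 * (1 + c) + C + 1 with hE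
  refine ⟨2 + d + d * Real.log d + 2 * C, Real.exp c, E ^ 2, ?_, Real.exp_pos _, by positivity,
    fun ℓ hℓ t ht => ?_⟩
  · nlinarith
  have ht' : (1 : ℝ) ≤ t := by exact_mod_cast ht
  have hb := hC ℓ hℓ t ht
  set W := selfNormalizedRadiusSq K d ℓ (Nat.log 2 (d + t)) with hW
  have hx : (1 : ℝ) ≤ 1 + ℓ := by linarith
  have hlogx : 0 ≤ Real.log (1 + ℓ) := Real.log_nonneg hx
  have hlogt : Real.log (1 + t) ≤ Real.log d + Real.log (1 + t / d) := by
    rw [← Real.log_mul (by positivity) (by positivity)]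
    refine Real.log_le_log (by positivity) ?_
    rw [mul_add, mul_div_cancel₀ _ (by positivity)]
    linarith
  have hlogprod : Real.log (Real.exp c * ((1 + ℓ) * √(1 + ℓ))) = c + 3 / 2 * Real.log (1 + ℓ) := by
    rw [Real.log_mul (by positivity) (by positivity), Real.log_exp,
      Real.log_mul (by positivity) (by positivity), Real.log_sqrt (by positivity)]
    ring
  refine ⟨fun h => ?_, fun h => ?_, ?_⟩
  · have h1 : c + 3 / 2 * Real.log (1 + ℓ) ≤ Real.log (1 + t) := by
      rw [← hlogprod]
      exact Real.log_le_log (by positivity) (by linarith)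
    have h2 : d * Real.log (1 + ℓ) ≤ d * (2 / 3 * (Real.log (1 + t) - c)) := by gcongr; linarith
    have h3 : d * Real.log (1 + t) ≤ d * (Real.log d + Real.log (1 + t / d)) := by gcongr
    have h4 : 0 ≤ d * Real.log (1 + t) := by
      have := Real.log_nonneg (show (1 : ℝ) ≤ 1 + t by linarith)
      positivity
    linarith
  · have h1 : Real.log (1 + t) ≤ 1 + (c + 3 / 2 * Real.log (1 + ℓ)) := by
      have h2 : Real.log (1 + t) ≤ Real.log (2 * t) := Real.log_le_log (by positivity) (by linarith)
      have h3 := Real.log_le_log (by positivity) h.le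
      rw [hlogprod] at h3
      rw [Real.log_mul (by norm_num) (by positivity)] at h2
      linarith [Real.log_two_lt_d9]
    -- Before that time `log (1 + t)` is `O(1 + log (1 + ℓ))`, which the fourth root `w` dominates.
    set w := √√(1 + ℓ) with hw
    have hw1 : 1 ≤ w := Real.one_le_sqrt.2 (Real.one_le_sqrt.2 hx)
    have hw2 : w ^ 2 = √(1 + ℓ) := Real.sq_sqrt (Real.sqrt_nonneg _)
    have hlw : Real.log (1 + ℓ) ≤ 4 * w := by
      have h2 : Real.log w = Real.log (1 + ℓ) / 4 := by
        rw [hw, Real.log_sqrt (Real.sqrt_nonneg _), Real.log_sqrt (by positivity)]; ring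
      have h3 := Real.log_le_sub_one_of_pos (show 0 < w by linarith)
      linarith
    have hup : W - 2 * ℓ ≤ E * w := by
      have h4 : d / 6 * Real.log (1 + t) ≤ d / 6 * (1 + (c + 3 / 2 * Real.log (1 + ℓ))) := by gcongr
      have h5 : d * Real.log (1 + ℓ) ≤ d * (4 * w) := by gcongr
      have h6 : (d / 6 * (1 + c) + C) * 1 ≤ (d / 6 * (1 + c) + C) * w := by gcongr
      rw [hE]
      linarith
    have hlow : 0 ≤ W - 2 * ℓ := by
      rw [hW, selfNormalizedRadiusSq]
      have := gridCost_nonneg K d ℓ (Nat.log 2 (d + t))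
      have : (0 : ℝ) ≤ d / 2 := by positivity
      linarith
    rw [← hw2, ← mul_pow]
    gcongr
  · have hhalf := half_le_mul_log_one_add_div hd ht
    have h1 : Real.log (1 + ℓ) ≤ ℓ := by
      have := Real.log_le_sub_one_of_pos (show 0 < 1 + ℓ by linarith)
      linarith
    have h2 : d * Real.log (1 + ℓ) ≤ d * ℓ := by gcongr
    have h3 : d / 6 * Real.log (1 + t) ≤ d / 6 * (Real.log d + Real.log (1 + t / d)) := by gcongr
    have h4 : 0 ≤ d * Real.log d := by positivity
    have h5 : (d * Real.log d + 2 * C) * (1 / 2) ≤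
        (d * Real.log d + 2 * C) * (d * Real.log (1 + t / d)) := by gcongr
    have h6 : 0 ≤ (d * Real.log d + 2 * C) * ℓ := by positivity
    have h7 : 0 ≤ (d : ℝ) * (d * Real.log (1 + t / d)) := by positivity
    have h8 : 0 ≤ (d : ℝ) * ℓ := by positivity
    nlinarith

end RadiusGrowth

/-! ### Model estimates and the uniform gap. -/

section ModelEstimates

/-- The joint shift leaves the residuals `Φ θ - μ` unchanged. -/
theorem isModelEstimate_add {Φ : Matrix (Fin K) (Fin d) ℝ} {α μ : Fin K → ℝ} {θ : Fin d → ℝ}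
    (h : IsModelEstimate Φ α μ θ) (v : Fin d → ℝ) :
    IsModelEstimate Φ α (μ + Φ *ᵥ v) (θ + v) := by
  intro θ'
  have h1 := h (θ' - v)
  simp only [mulVec_add, mulVec_sub, Pi.add_apply, Pi.sub_apply] at h1 ⊢
  convert h1 using 4 <;> ring

/-- Solutions of the normal equations are model estimates. -/
theorem isModelEstimate_of_gram_mulVec_eq {Φ : Matrix (Fin K) (Fin d) ℝ} {α μ : Fin K → ℝ}
    (hα : ∀ i, 0 ≤ α i) {θ : Fin d → ℝ} (h : gram Φ α *ᵥ θ = ∑ i, (α i * μ i) • Φ i) :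
    IsModelEstimate Φ α μ θ := by
  intro θ'
  have h1 : ∑ i, α i * ((Φ i ⬝ᵥ θ - μ i) * (Φ i ⬝ᵥ (θ' - θ))) = 0 := by
    have h2 := congrArg (fun x => (θ' - θ) ⬝ᵥ x) h
    simp only [dotProduct_gram_mulVec, dotProduct_sum, dotProduct_smul, smul_eq_mul] at h2
    rw [← sub_eq_zero, ← Finset.sum_sub_distrib] at h2
    rw [← h2]
    refine Finset.sum_congr rfl fun i _ => ?_
    rw [dotProduct_comm (θ' - θ) (Φ i)]
    ring
  have h3 : ∑ i, α i * ((Φ *ᵥ θ') i - μ i) ^ 2 = ∑ i, α i * ((Φ *ᵥ θ) i - μ i) ^ 2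
      + 2 * ∑ i, α i * ((Φ i ⬝ᵥ θ - μ i) * (Φ i ⬝ᵥ (θ' - θ)))
      + ∑ i, α i * (Φ i ⬝ᵥ (θ' - θ)) ^ 2 := by
    rw [Finset.mul_sum, ← Finset.sum_add_distrib, ← Finset.sum_add_distrib]
    refine Finset.sum_congr rfl fun i _ => ?_
    simp only [mulVec, dotProduct_sub]
    ring
  have h4 : 0 ≤ ∑ i, α i * (Φ i ⬝ᵥ (θ' - θ)) ^ 2 :=
    Finset.sum_nonneg fun i _ => mul_nonneg (hα i) (sq_nonneg _)
  rw [h3, h1]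
  linarith

/-- Positive weights, normalized, form a sampling distribution, and the solution of the normal
equations is its model estimate. -/
theorem exists_samplingDistribution {Φ : Matrix (Fin K) (Fin d) ℝ} {w : Fin K → ℝ}
    (hw : ∀ i, 0 ≤ w i) (hw0 : 0 < ∑ i, w i) (hgram : (gram Φ w).PosDef) (μ : Fin K → ℝ) :
    ∃ α ∈ samplingDistributions Φ,
      IsModelEstimate Φ α μ ((gram Φ w)⁻¹ *ᵥ ∑ i, (w i * μ i) • Φ i) := by
  set c := (∑ i, w i)⁻¹ with hc
  have hc0 : 0 < c := inv_pos.2 hw0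
  have hg : gram Φ (fun i => c * w i) = c • gram Φ w := gram_smul Φ c w
  refine ⟨fun i => c * w i, ⟨⟨fun i => mul_nonneg hc0.le (hw i), ?_⟩, ?_⟩,
    isModelEstimate_of_gram_mulVec_eq (fun i => mul_nonneg hc0.le (hw i)) ?_⟩
  · rw [← Finset.mul_sum, hc, inv_mul_cancel₀ hw0.ne']
  · rw [gram_eq_mul, hg]
    exact (hgram.smul hc0).isUnit
  · rw [hg, smul_mulVec, mulVec_inv_mulVec hgram, Finset.smul_sum]
    exact Finset.sum_congr rfl fun i _ => by rw [smul_smul, mul_assoc]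

/-- With `v = φ_k - φ_i` and small `c > 0`, the rewards `μ - c Φ v` are still in the region. All
their estimates are shifted by `-c v`, which lowers the gap to arm `i` by `c ‖v‖²`; as it stays
positive, it was at least `c ‖v‖²` for `μ`. -/
theorem exists_isModelGap {hdK : d < K} {Φ : Matrix (Fin K) (Fin d) ℝ}
    (hforced : (forcedDesign hdK.le Φ - 1).PosSemidef) {μ : Fin K → ℝ} {k : Fin K}
    (hμ : μ ∈ interior (robustObservationRegion Φ k)) :
    ∃ Δ : ℝ, 0 < Δ ∧ IsModelGap Φ μ k Δ := by
  -- Equal features would tie in every estimate; uniform weights provide one.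
  have hne : ∀ i, i ≠ k → Φ k ≠ Φ i := by
    intro i hi heq
    obtain ⟨α, hα, hest⟩ := exists_samplingDistribution (Φ := Φ) (w := fun _ => 1)
      (fun _ => zero_le_one) (by simp; omega)
      (gram_posDef hforced (fun _ => zero_le_one) fun _ => le_rfl) μ
    have h := (interior_subset hμ).2 α hα _ hest i hi
    simp [mulVec, heq] at h
  have hgap : ∀ i, ∃ Δ : ℝ, 0 < Δ ∧ (i ≠ k → ∀ α ∈ samplingDistributions Φ, ∀ θ,
      IsModelEstimate Φ α μ θ → Δ ≤ Φ k ⬝ᵥ θ - Φ i ⬝ᵥ θ) := by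
    intro i
    by_cases hi : i = k
    · exact ⟨1, one_pos, fun h => absurd hi h⟩
    set v := Φ k - Φ i with hv
    have hv0 : 0 < v ⬝ᵥ v := lt_of_le_of_ne (Finset.sum_nonneg fun i _ => mul_self_nonneg _)
      fun h => sub_ne_zero.2 (hne i hi) (dotProduct_self_eq_zero.1 h.symm)
    have hcont : Filter.Tendsto (fun c : ℝ => μ + Φ *ᵥ ((-c) • v)) (nhds 0) (nhds μ) := by
      have : Continuous fun c : ℝ => μ + Φ *ᵥ ((-c) • v) := by
        simp only [mulVec_smul]
        fun_prop
      simpa using this.tendsto 0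
    have hev := hcont.eventually (mem_interior_iff_mem_nhds.1 hμ)
    obtain ⟨c, hc, hc0⟩ := ((hev.filter_mono nhdsWithin_le_nhds).and
      (self_mem_nhdsWithin (s := Set.Ioi (0 : ℝ)))).exists
    have hc0' : 0 < c := hc0
    refine ⟨c * (v ⬝ᵥ v), mul_pos hc0' hv0, fun _ α hα θ hθ => ?_⟩
    have h := hc.2 α hα _ (isModelEstimate_add hθ _) i hi
    simp only [mulVec, dotProduct_add, dotProduct_smul, smul_eq_mul] at h
    have hvv : v ⬝ᵥ v = Φ k ⬝ᵥ v - Φ i ⬝ᵥ v := by rw [← sub_dotProduct]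
    rw [hvv]
    linarith
  choose g hg0 hg using hgap
  have hne' : (Finset.univ : Finset (Fin K)).Nonempty := ⟨k, Finset.mem_univ k⟩
  refine ⟨Finset.univ.inf' hne' g, ?_, fun α hα θ hθ i hi => ?_⟩
  · exact (Finset.lt_inf'_iff hne').2 fun i _ => hg0 i
  · exact (Finset.inf'_le g (Finset.mem_univ i)).trans (hg i hi α hα θ hθ)

end ModelEstimates

/-! ### Counting the plays of suboptimal arms. -/

section Mistakes

/-- The first summand solves the normal equations for the true means with the play counts as
weights; all the noise is in the second. -/
theorem lsEstimate_add (Φ : Matrix (Fin K) (Fin d) ℝ) (a : ℕ → Fin K) (μ : Fin K → ℝ) (e : ℕ → ℝ)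
    (n : ℕ) : lsEstimate Φ a (fun n => μ (a n) + e n) n =
      (gram Φ fun i => (playCount a n i : ℝ))⁻¹ *ᵥ (∑ i, ((playCount a n i : ℝ) * μ i) • Φ i)
        + (designMatrix Φ a n)⁻¹ *ᵥ responseVector Φ a e n := by
  rw [lsEstimate, ← designMatrix_eq_gram, ← mulVec_add]
  congr 1
  simp only [responseVector, add_smul, Finset.sum_add_distrib]
  congr 1
  rw [sum_range_comp_eq a n fun i => μ i • Φ i]
  exact Finset.sum_congr rfl fun i _ => by rw [mul_smul, Nat.cast_smul_eq_nsmul]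

/-- If the noise is controlled, then an arm played by mistake has been played only few times. -/
theorem sq_gap_le_of_mistake (hd : 0 < d) {hdK : d ≤ K} {Φ : Matrix (Fin K) (Fin d) ℝ}
    (hbounded : ∀ i, ‖WithLp.toLp 2 (Φ i)‖ ≤ 1)
    (hforced : (forcedDesign hdK Φ - 1).PosSemidef) {μ : Fin K → ℝ} {k : Fin K} {Δ : ℝ}
    (hΔ : IsModelGap Φ μ k Δ) {R δ : ℝ} {a : ℕ → Fin K} {e : ℕ → ℝ}
    (ha : FollowsOFUL hdK Φ R δ a fun n => μ (a n) + e n) {s : ℕ} (hs : a (d + s) ≠ k) {r ε : ℝ}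
    (hr : √(responseVector Φ a e (d + s) ⬝ᵥ
      ((designMatrix Φ a (d + s))⁻¹ *ᵥ responseVector Φ a e (d + s))) ≤ r)
    (hε : 0 ≤ ε) (hεΔ : ε ≤ Δ) (hrε : r ≤ √(confidenceRadiusSq d R δ (s + 1)) + ε) :
    (Δ - ε) ^ 2 ≤ (√(confidenceRadiusSq d R δ (s + 1)) + r) ^ 2 ∧
    playCount a (d + s) (a (d + s)) * (Δ - ε) ^ 2 ≤
      (√(confidenceRadiusSq d R δ (s + 1)) + r) ^ 2 := by
  set n := d + s with hn
  have hdn : d ≤ n := by omega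
  set ρ := √(confidenceRadiusSq d R δ (s + 1)) with hρ
  set V := designMatrix Φ a n with hVdef
  have hV : V.PosDef := designMatrix_posDef hforced ha.1 hdn
  have hr0 : 0 ≤ r := (Real.sqrt_nonneg _).trans hr
  have hρ0 : 0 ≤ ρ := Real.sqrt_nonneg _
  obtain ⟨θ, hθ, hmax⟩ := ha.2 s
  simp only [confidenceSet, Set.mem_ofPred_eq, ← hn, lsEstimate_add, ← hVdef, ← hρ] at hθ hmax
  have hgramV : (gram Φ fun i => (playCount a n i : ℝ)) = V := (designMatrix_eq_gram Φ a n).symm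
  obtain ⟨α, hα, hest⟩ := exists_samplingDistribution (Φ := Φ)
    (w := fun i => (playCount a n i : ℝ)) (fun i => Nat.cast_nonneg _)
    (by
      have := sum_playCount a n
      have h2 : ∑ i, (playCount a n i : ℝ) = n := by exact_mod_cast this
      rw [h2]
      exact_mod_cast (show 0 < n by omega)) (hgramV ▸ hV) μ
  have hgap := hΔ α hα _ hest (a n) hs
  have hopt := gap_le_of_optimistic hV hρ0 hr hθ (fun θ' h' => hmax k θ' h')
  -- From `φ φᵀ ≤ 1 ≤ V`, thanks to the forced plays.
  have hself : ∀ i, Φ i ⬝ᵥ (V⁻¹ *ᵥ Φ i) ≤ 1 := by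
    intro i
    have := mul_inv_quadForm_le_one (c := 1) hV fun v => by
      rw [one_mul]
      exact (sq_dotProduct_le_of_norm_le_one (hbounded i) v).trans
        (dotProduct_self_le_quadForm_designMatrix hforced ha.1 hdn v)
    linarith
  -- From `N φ φᵀ ≤ V`, with `N` the number of earlier plays of this arm.
  have hcount : playCount a n (a n) * (Φ (a n) ⬝ᵥ (V⁻¹ *ᵥ Φ (a n))) ≤ 1 := by
    refine mul_inv_quadForm_le_one hV fun v => ?_
    rw [← hgramV, quadForm_gram]
    exact Finset.single_le_sum (f := fun i => (playCount a n i : ℝ) * (Φ i ⬝ᵥ v) ^ 2)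
      (fun i _ => mul_nonneg (Nat.cast_nonneg _) (sq_nonneg _)) (Finset.mem_univ _)
  set X := √(Φ (a n) ⬝ᵥ (V⁻¹ *ᵥ Φ (a n))) with hX
  set Y := √(Φ k ⬝ᵥ (V⁻¹ *ᵥ Φ k)) with hY
  have hX2 : X ^ 2 = Φ (a n) ⬝ᵥ (V⁻¹ *ᵥ Φ (a n)) := Real.sq_sqrt (quadForm_inv_nonneg hV _)
  have hY0 : 0 ≤ Y := Real.sqrt_nonneg _
  have hX0 : 0 ≤ X := Real.sqrt_nonneg _
  have hY1 : Y ≤ 1 := Real.sqrt_le_one.2 (hself k)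
  have hYε : (r - ρ) * Y ≤ ε := by nlinarith
  have hkey : Δ - ε ≤ (ρ + r) * X := by linarith
  have hsq : (Δ - ε) ^ 2 ≤ (ρ + r) ^ 2 * X ^ 2 := by
    rw [← mul_pow]
    exact pow_le_pow_left₀ (by linarith) hkey 2
  have hB : 0 ≤ (ρ + r) ^ 2 := sq_nonneg _
  rw [← hX2] at hcount
  have hX1 : X ^ 2 ≤ 1 := hX2 ▸ hself (a n)
  constructor
  · nlinarith
  · have h1 : (playCount a n (a n) : ℝ) * (Δ - ε) ^ 2 ≤
        playCount a n (a n) * ((ρ + r) ^ 2 * X ^ 2) := by gcongr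
    nlinarith

/-- If every play selected by `Q` is a play of an arm played at most `X` times before, then at most
`2 K X` plays are selected. -/
theorem card_filter_le_of_playCount_le (a : ℕ → Fin K) (Q : ℕ → Prop) [DecidablePred Q] (t : ℕ)
    {X : ℝ} (hX : 0 ≤ X)
    (h : ∀ s < t, Q s → 1 ≤ X ∧ (playCount a (d + s) (a (d + s)) : ℝ) ≤ X) :
    (((Finset.range t).filter Q).card : ℝ) ≤ 2 * K * X := by
  by_cases hne : ((Finset.range t).filter Q).Nonempty
  swap
  · rw [Finset.not_nonempty_iff_eq_empty.1 hne]
    simp only [Finset.card_empty, Nat.cast_zero]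
    positivity
  obtain ⟨s₀, hs₀⟩ := hne
  have hX1 : 1 ≤ X := by
    rw [Finset.mem_filter, Finset.mem_range] at hs₀
    exact (h s₀ hs₀.1 hs₀.2).1
  have hcard : ((Finset.range t).filter Q).card ≤
      ((Finset.univ : Finset (Fin K)) ×ˢ Finset.range (⌊X⌋₊ + 1)).card := by
    -- A play is determined by its arm and the number of earlier plays of that arm.
    refine Finset.card_le_card_of_injOn (fun s => (a (d + s), playCount a (d + s) (a (d + s))))
      ?_ ?_
    · intro s hs
      simp only [Finset.coe_filter, Finset.mem_range, Set.mem_ofPred_eq] at hs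
      simp only [Finset.coe_product, Finset.coe_univ, Finset.coe_range, Set.mem_prod,
        Set.mem_univ, true_and, Set.mem_Iio]
      exact Nat.lt_succ_of_le (Nat.le_floor (h s hs.1 hs.2).2)
    · have hlt : ∀ s s', s < s' → (a (d + s), playCount a (d + s) (a (d + s))) ≠
          (a (d + s'), playCount a (d + s') (a (d + s'))) := by
        intro s s' hss heq
        rw [Prod.mk.injEq] at heq
        have h1 := playCount_succ a (d + s) (a (d + s))
        rw [if_pos rfl] at h1
        have h2 := playCount_mono a (a (d + s)) (show d + s + 1 ≤ d + s' by omega)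
        simp only at h2
        rw [← heq.1] at heq
        omega
      intro s _ s' _ heq
      rcases lt_trichotomy s s' with hh | hh | hh
      · exact absurd heq (hlt s s' hh)
      · exact hh
      · exact absurd heq.symm (hlt s' s hh)
  rw [Finset.card_product, Finset.card_univ, Fintype.card_fin, Finset.card_range] at hcard
  calc (((Finset.range t).filter Q).card : ℝ) ≤ K * (⌊X⌋₊ + 1) := by exact_mod_cast hcard
    _ ≤ K * (X + X) := by gcongr; exact Nat.floor_le hX
    _ = 2 * K * X := by ring

theorem suboptimalPlays_eq_card (k : Fin K) (a : ℕ → Fin K) (t : ℕ) :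
    suboptimalPlays d k a t = ((Finset.range t).filter fun s => a (d + s) ≠ k).card := by
  rw [suboptimalPlays, Finset.sum_boole]

theorem suboptimalPlays_le (k : Fin K) (a : ℕ → Fin K) (t : ℕ) : suboptimalPlays d k a t ≤ t := by
  rw [suboptimalPlays_eq_card]
  exact_mod_cast (Finset.card_filter_le _ _).trans (Finset.card_range t).le

theorem regret_le (μ : Fin K → ℝ) (k : Fin K) (a : ℕ → Fin K) (t : ℕ) :
    regret d μ k a t ≤ maxGap μ k * suboptimalPlays d k a t := by
  rw [regret, suboptimalPlays, Finset.mul_sum]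
  refine Finset.sum_le_sum fun s _ => ?_
  split_ifs with h
  · rw [mul_one]
    exact le_ciSup (f := fun i => μ k - μ i) (Set.finite_range _).bddAbove _
  · rw [not_not.1 h]; simp

theorem maxGap_nonneg (μ : Fin K → ℝ) (k : Fin K) : 0 ≤ maxGap μ k := by
  have := le_ciSup (f := fun i => μ k - μ i) (Set.finite_range _).bddAbove k
  simpa [maxGap] using this

theorem regret_le_regretBound {μ : Fin K → ℝ} {k : Fin K} {a : ℕ → Fin K} {t : ℕ} {R δ Δ : ℝ}
    (h : suboptimalPlays d k a t ≤ playBound d R δ Δ t) :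
    regret d μ k a t ≤ regretBound d R δ (maxGap μ k) Δ t := by
  refine (regret_le μ k a t).trans ((mul_le_mul_of_nonneg_left h (maxGap_nonneg μ k)).trans_eq ?_)
  rw [playBound, regretBound]
  ring

end Mistakes

/-! ### Bounds on every path with controlled noise. -/

section PathwiseBounds

theorem logTerm_eq (hd : 0 < d) {δ : ℝ} (hδ : 0 < δ) (t : ℕ) :
    logTerm d δ t = -Real.log δ + d * Real.log (1 + t / d) / 2 := by
  have : (0 : ℝ) < 1 + t / d := by positivity
  rw [logTerm, Real.log_div (by positivity) hδ.ne', Real.log_rpow this]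
  ring

theorem log_one_add_div_mono (d : ℕ) : Monotone fun t : ℕ => d * Real.log (1 + (t : ℝ) / d) := by
  intro t t' h
  have h1 : (t : ℝ) ≤ t' := by exact_mod_cast h
  have : Real.log (1 + (t : ℝ) / d) ≤ Real.log (1 + (t' : ℝ) / d) :=
    Real.log_le_log (by positivity) (by gcongr)
  simp only
  gcongr

theorem logTerm_mono (hd : 0 < d) {δ : ℝ} (hδ : 0 < δ) : Monotone (logTerm d δ) := by
  intro t t' h
  have := log_one_add_div_mono d h
  rw [logTerm_eq hd hδ, logTerm_eq hd hδ]
  simp only at this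
  linarith

theorem one_add_neg_log_le (hd : 0 < d) {δ : ℝ} (hδ : 0 < δ) (hδ1 : δ < 1) {t : ℕ} (ht : 1 ≤ t) :
    1 + -Real.log δ ≤ 4 * logTerm d δ t := by
  rw [logTerm_eq hd hδ]
  linarith [half_le_mul_log_one_add_div hd ht, Real.log_neg hδ hδ1]

/-- The noise of the run `a` stays within the self-normalized radius at all times. -/
def NoiseControlled (Φ : Matrix (Fin K) (Fin d) ℝ) (R δ : ℝ) (a : ℕ → Fin K) (e : ℕ → ℝ) : Prop :=
  ∀ n, d ≤ n → √(responseVector Φ a e n ⬝ᵥ ((designMatrix Φ a n)⁻¹ *ᵥ responseVector Φ a e n)) ≤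
    R * √(selfNormalizedRadiusSq K d (-Real.log δ) (Nat.log 2 (n + 1)))

/-- Both radii are at most `R √(2 C L)`, so the square of their sum is at most `8 C R² L`. The bound
below by 1 lets `card_filter_le_of_playCount_le` absorb a rounding. -/
theorem playCount_le_of_mistake (hd : 0 < d) {hdK : d ≤ K} {Φ : Matrix (Fin K) (Fin d) ℝ}
    (hbounded : ∀ i, ‖WithLp.toLp 2 (Φ i)‖ ≤ 1)
    (hforced : (forcedDesign hdK Φ - 1).PosSemidef) {μ : Fin K → ℝ} {k : Fin K} {Δ : ℝ}
    (hΔ : IsModelGap Φ μ k Δ) {R δ : ℝ} (hR : 0 < R) (hδ : 0 < δ) (hδ1 : δ < 1)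
    {a : ℕ → Fin K} {e : ℕ → ℝ}
    (ha : FollowsOFUL hdK Φ R δ a fun n => μ (a n) + e n) (hnoise : NoiseControlled Φ R δ a e)
    {s : ℕ} (hs : a (d + s) ≠ k) {ε C : ℝ} (hε : 0 ≤ ε) (hεΔ : ε < Δ) (hC : 1 ≤ C)
    (hCr : selfNormalizedRadiusSq K d (-Real.log δ) (Nat.log 2 (d + (s + 1))) ≤
      C * (2 * logTerm d δ (s + 1)))
    (hrε : R * √(selfNormalizedRadiusSq K d (-Real.log δ) (Nat.log 2 (d + (s + 1)))) ≤
      R * √(2 * logTerm d δ (s + 1)) + ε) {t : ℕ} (hst : s < t) :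
    1 ≤ 8 * C * R ^ 2 * logTerm d δ t / (Δ - ε) ^ 2 ∧
    (playCount a (d + s) (a (d + s)) : ℝ) ≤ 8 * C * R ^ 2 * logTerm d δ t / (Δ - ε) ^ 2 := by
  have hρ : √(confidenceRadiusSq d R δ (s + 1)) = R * √(2 * logTerm d δ (s + 1)) := by
    rw [confidenceRadiusSq, show 2 * R ^ 2 * logTerm d δ (s + 1) =
      R ^ 2 * (2 * logTerm d δ (s + 1)) by ring, Real.sqrt_mul (sq_nonneg R), Real.sqrt_sq hR.le]
  have hL0 : 0 ≤ logTerm d δ (s + 1) := by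
    have := one_add_neg_log_le hd hδ hδ1 (show 1 ≤ s + 1 by omega)
    linarith [Real.log_neg hδ hδ1]
  have h := sq_gap_le_of_mistake hd hbounded hforced hΔ ha hs (hnoise (d + s) (by omega)) hε
    hεΔ.le (by rw [hρ]; exact hrε)
  rw [hρ] at h
  set W := selfNormalizedRadiusSq K d (-Real.log δ) (Nat.log 2 (d + s + 1)) with hW
  have hmain : (R * √(2 * logTerm d δ (s + 1)) + R * √W) ^ 2 ≤ 8 * C * R ^ 2 * logTerm d δ t := by
    set L := logTerm d δ (s + 1) with hL
    have hLt : L ≤ logTerm d δ t := logTerm_mono hd hδ hst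
    have h1 : √(2 * L) ≤ √(C * (2 * L)) := Real.sqrt_le_sqrt (by nlinarith)
    have h2 : √W ≤ √(C * (2 * L)) := Real.sqrt_le_sqrt hCr
    calc (R * √(2 * L) + R * √W) ^ 2 ≤ (R * √(C * (2 * L)) + R * √(C * (2 * L))) ^ 2 := by gcongr
      _ = 4 * R ^ 2 * √(C * (2 * L)) ^ 2 := by ring
      _ = 8 * C * R ^ 2 * L := by rw [Real.sq_sqrt (by positivity)]; ring
      _ ≤ _ := by gcongr
  have hpos : 0 < (Δ - ε) ^ 2 := pow_pos (by linarith) 2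
  rw [le_div_iff₀ hpos, le_div_iff₀ hpos, one_mul]
  exact ⟨h.1.trans hmain, h.2.trans hmain⟩

theorem playBound_eq {R δ Δ : ℝ} (t : ℕ) :
    playBound d R δ Δ t =
      4 / Δ * (√t * R * √(logTerm d δ t) * √(d * Real.log (1 + t / d))) := by
  rw [playBound, Real.log_pow]
  ring

theorem sqrt_add_le_add_div {u g : ℝ} (hu : 0 < u) (hg : 0 ≤ g) : √(u + g) ≤ √u + g / √u := by
  have hs : 0 < √u := Real.sqrt_pos.2 hu
  have h2 : √u ^ 2 = u := Real.sq_sqrt hu.le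
  rw [Real.sqrt_le_left (by positivity), add_sq, h2]
  have : 2 * √u * (g / √u) = 2 * g := by field_simp
  rw [this]
  nlinarith [sq_nonneg (g / √u)]

/-- In a round in which the claimed bound is not trivial, the self-normalized radius hardly exceeds
the radius used by the algorithm. -/
theorem radius_le_add_of_nontrivial {R ℓ L D W t C C₁ C₂ Δ : ℝ} (hR : 0 < R) (hℓ : 0 ≤ ℓ)
    (hL : 1 + ℓ ≤ 4 * L) (hLeq : L = ℓ + D / 2) (hD : 1 / 2 ≤ D) (ht : 0 < t) (hC : 0 < C)
    (hΔ : 0 < Δ) (hC₁ : 0 < C₁) (hC₂ : 0 < C₂) (hCC : 64 * C₁ * C₂ = (C * Δ) ^ 2)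
    (hW : 2 * ℓ ≤ W) (hlarge : C₁ * ((1 + ℓ) * √(1 + ℓ)) ≤ t → W ≤ 2 * L)
    (hsmall : t < C₁ * ((1 + ℓ) * √(1 + ℓ)) → (W - 2 * ℓ) ^ 2 ≤ C₂ * √(1 + ℓ))
    (hnt : C * (√t * R * √L * √D) < t) : R * √W ≤ R * √(2 * L) + Δ / 2 := by
  rcases le_or_gt (C₁ * ((1 + ℓ) * √(1 + ℓ))) t with h | h
  · have : √W ≤ √(2 * L) := Real.sqrt_le_sqrt (hlarge h)
    have : R * √W ≤ R * √(2 * L) := by gcongr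
    linarith
  have hL0 : 0 < L := by linarith
  set x := 1 + ℓ with hx
  have hx1 : 1 ≤ x := by linarith
  have hG := hsmall h
  set G := W - 2 * ℓ with hGdef
  have hG0 : 0 ≤ G := by linarith
  have h1 : √W ≤ √(2 * L) + G / √(2 * L) :=
    (Real.sqrt_le_sqrt (show W ≤ 2 * L + G by linarith)).trans
      (sqrt_add_le_add_div (by positivity) hG0)
  -- Nontriviality of the bound, with `D ≥ 1 / 2`, limits `R² L` by a multiple of `t`.
  have h2 : C ^ 2 * (R ^ 2 * L) < 2 * t := by
    have h3 : (C * (√t * R * √L * √D)) ^ 2 < t ^ 2 := pow_lt_pow_left₀ hnt (by positivity) two_ne_zero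
    have h4 : (C * (√t * R * √L * √D)) ^ 2 = t * (C ^ 2 * (R ^ 2 * L) * D) := by
      simp only [mul_pow]
      rw [Real.sq_sqrt ht.le, Real.sq_sqrt hL0.le, Real.sq_sqrt (by linarith)]
      ring
    rw [h4, pow_two t] at h3
    have h5 := lt_of_mul_lt_mul_left h3 ht.le
    have h6 : 0 ≤ C ^ 2 * (R ^ 2 * L) := by positivity
    nlinarith
  -- Now `R² L` is `O(x^(3/2))` and `G²` is `O(x^(1/2))`. Their product is of order `x² ≤ 16 L²`, so
  -- `L` cancels and `hCC` leaves exactly `(Δ / 2)²`.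
  have h3 : R * (G / √(2 * L)) ≤ Δ / 2 := by
    refine abs_le_of_sq_le_sq' ?_ (by positivity) |>.2
    rw [mul_pow, div_pow, Real.sq_sqrt (by positivity), ← mul_div_assoc,
      div_le_iff₀ (by positivity)]
    have hss : √x * √x = x := Real.mul_self_sqrt (by linarith)
    have h4 : C ^ 2 * (R ^ 2 * L) * G ^ 2 ≤ 2 * (C₁ * (x * √x)) * (C₂ * √x) := by
      have : C ^ 2 * (R ^ 2 * L) ≤ 2 * (C₁ * (x * √x)) := by linarith
      gcongr
    have h5 : 2 * (C₁ * (x * √x)) * (C₂ * √x) = 2 * C₁ * C₂ * x ^ 2 := by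
      calc _ = 2 * C₁ * C₂ * x * (√x * √x) := by ring
        _ = _ := by rw [hss]; ring
    have h6 : x ^ 2 ≤ (4 * L) ^ 2 := by gcongr
    have h7 : C₁ * C₂ * x ^ 2 ≤ C₁ * C₂ * (4 * L) ^ 2 := by gcongr
    have h8 : (C ^ 2 * L) * (R ^ 2 * G ^ 2) ≤ (C ^ 2 * L) * ((Δ / 2) ^ 2 * (2 * L)) := by
      calc (C ^ 2 * L) * (R ^ 2 * G ^ 2) = C ^ 2 * (R ^ 2 * L) * G ^ 2 := by ring
        _ ≤ 2 * (C₁ * C₂ * x ^ 2) := by linarith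
        _ ≤ 2 * (C₁ * C₂ * (4 * L) ^ 2) := by linarith
        _ = (64 * C₁ * C₂) * L ^ 2 / 2 := by ring
        _ = _ := by rw [hCC]; ring
    exact le_of_mul_le_mul_left h8 (by positivity)
  calc R * √W ≤ R * (√(2 * L) + G / √(2 * L)) := by gcongr
    _ ≤ _ := by rw [mul_add]; linarith

/-- Rounds in which a multiple `B` of the claimed bound is trivial number at most `B t`. In the
others the noise excess is at most `Δ / 2`, so mistakes there are logarithmic in number, and this
too is a multiple of `B t`. -/
theorem exists_gap_forall_suboptimalPlays_le (hd : 0 < d) {hdK : d ≤ K}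
    {Φ : Matrix (Fin K) (Fin d) ℝ} (hbounded : ∀ i, ‖WithLp.toLp 2 (Φ i)‖ ≤ 1)
    (hforced : (forcedDesign hdK Φ - 1).PosSemidef) {μ : Fin K → ℝ} {k : Fin K} {Δ : ℝ}
    (hΔ0 : 0 < Δ) (hΔ : IsModelGap Φ μ k Δ) :
    ∃ Δmin : ℝ, 0 < Δmin ∧ Δmin ≤ Δ ∧ ∀ R : ℝ, 0 < R → ∀ δ : ℝ, 0 < δ → δ < 1 →
      ∀ (a : ℕ → Fin K) (e : ℕ → ℝ), FollowsOFUL hdK Φ R δ a (fun n => μ (a n) + e n) →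
        NoiseControlled Φ R δ a e → ∀ t, suboptimalPlays d k a t ≤ playBound d R δ Δmin t := by
  obtain ⟨C₀, C₁, C₂, hC₀, hC₁, hC₂, hconst⟩ := exists_radius_constants K hd
  set C : ℝ := 8 * √(C₁ * C₂) / Δ with hCdef
  have hC : 0 < C := by positivity
  have hCC : 64 * C₁ * C₂ = (C * Δ) ^ 2 := by
    rw [hCdef, div_mul_cancel₀ _ hΔ0.ne', mul_pow, Real.sq_sqrt (by positivity)]
    ring
  set F : ℝ := 1 + 2 * K * C₀ / (C₁ * C₂) with hF
  have hF1 : 1 ≤ F := by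
    have : 0 ≤ 2 * K * C₀ / (C₁ * C₂) := by positivity
    linarith
  -- This makes `4 / Δmin ≥ F C`, while `Δmin ≤ Δ` keeps it a gap.
  refine ⟨min Δ (4 / (F * C)), lt_min hΔ0 (by positivity), min_le_left _ _,
    fun R hR δ hδ hδ1 a e ha hnoise t => ?_⟩
  have hℓ : 0 ≤ -Real.log δ := by linarith [Real.log_neg hδ hδ1]
  set B : ℕ → ℝ := fun u =>
    C * (√u * R * √(logTerm d δ u) * √(d * Real.log (1 + u / d))) with hB
  have hB0 : ∀ u, 0 ≤ B u := fun u => by positivity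
  have hBmono : Monotone B := by
    intro u v huv
    have h1 : (u : ℝ) ≤ v := by exact_mod_cast huv
    have h2 := logTerm_mono hd hδ huv
    have h3 := log_one_add_div_mono d huv
    simp only [hB] at h3 ⊢
    gcongr
  have hbound : F * B t ≤ playBound d R δ (min Δ (4 / (F * C))) t := by
    rw [playBound_eq]
    have h1 : F * C ≤ 4 / min Δ (4 / (F * C)) := by
      rw [le_div_iff₀ (lt_min hΔ0 (by positivity))]
      calc F * C * min Δ (4 / (F * C)) ≤ F * C * (4 / (F * C)) := by
            gcongr; exact min_le_right _ _
        _ = 4 := by field_simp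
    rw [hB]
    simp only
    rw [← mul_assoc]
    gcongr
  refine le_trans ?_ hbound
  rcases le_or_gt (t : ℝ) (B t) with htriv | hnt
  · exact (suboptimalPlays_le k a t).trans (htriv.trans (le_mul_of_one_le_left (hB0 t) hF1))
  have ht : 1 ≤ t := by
    rcases Nat.eq_zero_or_pos t with h | h
    · subst h; simp [hB] at hnt
    · exact h
  classical
  set X : ℝ := 8 * C₀ * R ^ 2 * logTerm d δ t / (Δ - Δ / 2) ^ 2 with hX
  have hLt := one_add_neg_log_le hd hδ hδ1 ht
  have hLt0 : 0 < logTerm d δ t := by linarith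
  have hX0 : 0 ≤ X := by positivity
  have hcard1 : (((Finset.range t).filter fun s => ((s + 1 : ℕ) : ℝ) ≤ B (s + 1)).card : ℝ) ≤ B t := by
    have hsub : ((Finset.range t).filter fun s => ((s + 1 : ℕ) : ℝ) ≤ B (s + 1)) ⊆
        Finset.range ⌊B t⌋₊ := by
      intro s hs
      rw [Finset.mem_filter, Finset.mem_range] at hs
      exact Finset.mem_range.2 (Nat.le_floor (hs.2.trans (hBmono hs.1)))
    calc _ ≤ (⌊B t⌋₊ : ℝ) := by
          exact_mod_cast (Finset.card_le_card hsub).trans (Finset.card_range _).le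
      _ ≤ B t := Nat.floor_le (hB0 t)
  have hcard2 : (((Finset.range t).filter fun s =>
      a (d + s) ≠ k ∧ B (s + 1) < ((s + 1 : ℕ) : ℝ)).card : ℝ) ≤ 2 * K * X := by
    refine card_filter_le_of_playCount_le (d := d) a _ t hX0 fun s hs hQ => ?_
    have hs1 : 1 ≤ s + 1 := by omega
    obtain ⟨c1, c2, c3⟩ := hconst _ hℓ (s + 1) hs1
    have hLeq := logTerm_eq hd hδ (s + 1)
    have hL2 : 2 * -Real.log δ + d * Real.log (1 + ((s + 1 : ℕ) : ℝ) / d) =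
        2 * logTerm d δ (s + 1) := by rw [hLeq]; ring
    rw [hL2] at c1 c3
    have hW : 2 * -Real.log δ ≤
        selfNormalizedRadiusSq K d (-Real.log δ) (Nat.log 2 (d + (s + 1))) := by
      rw [selfNormalizedRadiusSq]
      have h1 := gridCost_nonneg K d (-Real.log δ) (Nat.log 2 (d + (s + 1)))
      have h2 : (0 : ℝ) ≤ d / 2 := by positivity
      linarith
    exact playCount_le_of_mistake hd hbounded hforced hΔ hR hδ hδ1 ha hnoise hQ.1
      (by positivity) (by linarith) hC₀ c3
      (radius_le_add_of_nontrivial hR hℓ (one_add_neg_log_le hd hδ hδ1 hs1) hLeq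
        (half_le_mul_log_one_add_div hd hs1) (by positivity) hC hΔ0 hC₁ hC₂ hCC hW c1 c2 hQ.2) hs
  have hsplit : suboptimalPlays d k a t ≤ B t + 2 * K * X := by
    rw [suboptimalPlays_eq_card]
    have hsub : ((Finset.range t).filter fun s => a (d + s) ≠ k) ⊆
        ((Finset.range t).filter fun s => ((s + 1 : ℕ) : ℝ) ≤ B (s + 1)) ∪
        ((Finset.range t).filter fun s => a (d + s) ≠ k ∧ B (s + 1) < ((s + 1 : ℕ) : ℝ)) := by
      intro s hs
      rw [Finset.mem_filter] at hs
      rw [Finset.mem_union, Finset.mem_filter, Finset.mem_filter]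
      rcases le_or_gt ((s + 1 : ℕ) : ℝ) (B (s + 1)) with h | h
      · exact Or.inl ⟨hs.1, h⟩
      · exact Or.inr ⟨hs.1, hs.2, h⟩
    have h1 := (Finset.card_le_card hsub).trans (Finset.card_union_le _ _)
    calc _ ≤ (((Finset.range t).filter fun s => ((s + 1 : ℕ) : ℝ) ≤ B (s + 1)).card : ℝ) +
        (((Finset.range t).filter fun s =>
          a (d + s) ≠ k ∧ B (s + 1) < ((s + 1 : ℕ) : ℝ)).card : ℝ) := by exact_mod_cast h1
      _ ≤ _ := add_le_add hcard1 hcard2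
  refine hsplit.trans ?_
  -- If `B t = √t y < t`, then `y < √t`, so `y² ≤ B t`; and `y²` is `C² R² L D` with `D ≥ 1 / 2`.
  have hRL : C ^ 2 * (R ^ 2 * logTerm d δ t) ≤ 2 * B t := by
    set D := d * Real.log (1 + (t : ℝ) / d) with hD
    have hD2 : 1 / 2 ≤ D := half_le_mul_log_one_add_div hd ht
    set y := C * R * √(logTerm d δ t) * √D with hy
    have hy0 : 0 ≤ y := by positivity
    have hst : 0 < √(t : ℝ) := Real.sqrt_pos.2 (by positivity)
    have hBy : B t = √t * y := by simp only [hB, hy]; ring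
    have htt : √(t : ℝ) * √t = t := Real.mul_self_sqrt (by positivity)
    have hyt : y ≤ √t := by
      rw [hBy] at hnt
      exact (lt_of_mul_lt_mul_left (hnt.trans_eq htt.symm) hst.le).le
    have hyy : y * y = C ^ 2 * (R ^ 2 * logTerm d δ t) * D := by
      rw [← pow_two, hy]
      simp only [mul_pow]
      rw [Real.sq_sqrt hLt0.le, Real.sq_sqrt (by linarith)]
      ring
    have h1 : y * y ≤ B t := by rw [hBy]; gcongr
    have h2 : 0 ≤ C ^ 2 * (R ^ 2 * logTerm d δ t) := by positivity
    nlinarith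
  have hXB : 2 * K * X ≤ 2 * K * C₀ / (C₁ * C₂) * B t := by
    have h1 : X = 32 * C₀ / (C * Δ) ^ 2 * (C ^ 2 * (R ^ 2 * logTerm d δ t)) := by
      rw [hX]; field_simp; ring
    rw [h1, ← hCC]
    calc 2 * K * (32 * C₀ / (64 * C₁ * C₂) * (C ^ 2 * (R ^ 2 * logTerm d δ t)))
        ≤ 2 * K * (32 * C₀ / (64 * C₁ * C₂) * (2 * B t)) := by gcongr
      _ = _ := by field_simp; ring
  rw [hF, add_mul, one_mul]
  linarith

/-- The logarithmic term is eventually at most `q t`; the chosen `q` gives `c √L ≤ (c' / 2) √t`, and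
the other half of `c'` pays for `T`. -/
theorem eventually_add_mul_logTerm_le (hd : 0 < d) {δ : ℝ} (hδ : 0 < δ) (hδ1 : δ < 1) {T c c' : ℝ}
    (hT : 0 ≤ T) (hc : 0 < c) (hc' : 0 < c') :
    ∀ᶠ t : ℕ in Filter.atTop, T + c * logTerm d δ t ≤ c' * (√t * √(logTerm d δ t)) := by
  set q : ℝ := (c' / (2 * c)) ^ 2 with hq
  have hq0 : 0 < q := by positivity
  have h1 := tendsto_natCast_atTop_atTop (R := ℝ) |>.eventually_ge_atTop
    (2 * (-Real.log δ + d / 2 * (q - Real.log q)) / q)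
  have h2 := tendsto_natCast_atTop_atTop (R := ℝ) |>.eventually_ge_atTop ((4 * T / c') ^ 2)
  filter_upwards [h1, h2, Filter.eventually_ge_atTop 1] with t ht1 ht2 ht
  have hd' : (0 : ℝ) < d := by exact_mod_cast hd
  have hL := one_add_neg_log_le hd hδ hδ1 ht
  have hL4 : 1 / 4 ≤ logTerm d δ t := by linarith [Real.log_neg hδ hδ1]
  have hLq : logTerm d δ t ≤ q * t := by
    rw [logTerm_eq hd hδ]
    have h3 := Real.log_le_sub_one_of_pos (show 0 < q * (1 + t / d) by positivity)
    rw [Real.log_mul hq0.ne' (by positivity)] at h3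
    have h4 : d * Real.log (1 + t / d) ≤ d * (q * (1 + t / d) - Real.log q) := by
      gcongr; linarith
    have h5 : d * (q * (1 + t / d) - Real.log q) = d * (q - Real.log q) + q * t := by
      field_simp; ring
    rw [div_le_iff₀ hq0] at ht1
    linarith
  set L := logTerm d δ t with hLdef
  have hsL : 1 / 2 ≤ √L := Real.le_sqrt_of_sq_le (by linarith)
  have hs1 : c * √L ≤ c' / 2 * √t := by
    have h3 : √L ≤ √(q * t) := Real.sqrt_le_sqrt hLq
    rw [Real.sqrt_mul hq0.le, hq, Real.sqrt_sq (by positivity)] at h3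
    calc c * √L ≤ c * (c' / (2 * c) * √t) := by gcongr
      _ = _ := by field_simp
  have hs2 : 2 * T ≤ c' / 2 * √t := by
    have h3 : 4 * T / c' ≤ √t := Real.le_sqrt_of_sq_le ht2
    rw [div_le_iff₀ hc'] at h3
    linarith
  have hLL : √L * √L = L := Real.mul_self_sqrt (by linarith)
  have h3 : T ≤ 2 * T * √L := by nlinarith
  calc T + c * L ≤ 2 * T * √L + c * √L * √L := by rw [mul_assoc c, hLL]; linarith
    _ ≤ c' / 2 * √t * √L + c' / 2 * √t * √L := by gcongr
    _ = _ := by ring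

/-- After time `T` the noise stays within the algorithm's radius, so the full gap is available (`ε =
0`, `C = 1`). The first `T` rounds are all counted as mistakes. -/
theorem exists_time_forall_suboptimalPlays_le (hd : 0 < d) {hdK : d ≤ K}
    {Φ : Matrix (Fin K) (Fin d) ℝ} (hbounded : ∀ i, ‖WithLp.toLp 2 (Φ i)‖ ≤ 1)
    (hforced : (forcedDesign hdK Φ - 1).PosSemidef) {μ : Fin K → ℝ} {k : Fin K} {Δ : ℝ}
    (hΔ0 : 0 < Δ) (hΔ : IsModelGap Φ μ k Δ) {R δ : ℝ} (hR : 0 < R) (hδ : 0 < δ) (hδ1 : δ < 1) :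
    ∃ T₀ : ℕ, ∀ (a : ℕ → Fin K) (e : ℕ → ℝ),
      FollowsOFUL hdK Φ R δ a (fun n => μ (a n) + e n) → NoiseControlled Φ R δ a e →
        ∀ t, T₀ ≤ t → suboptimalPlays d k a t ≤ playBound d R δ Δ t := by
  obtain ⟨C₀, C₁, C₂, -, -, -, hconst⟩ := exists_radius_constants K hd
  have hℓ : 0 ≤ -Real.log δ := by linarith [Real.log_neg hδ hδ1]
  set T : ℕ := ⌈C₁ * ((1 + -Real.log δ) * √(1 + -Real.log δ))⌉₊ with hT
  obtain ⟨T₀, hT₀⟩ := Filter.eventually_atTop.1 ((eventually_add_mul_logTerm_le hd hδ hδ1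
    (T := T) (c := 16 * (K + 1) * R ^ 2 / Δ ^ 2) (c' := 2 * R / Δ) (Nat.cast_nonneg _)
    (by positivity) (by positivity)).and (Filter.eventually_ge_atTop 1))
  refine ⟨T₀, fun a e ha hnoise t ht => ?_⟩
  obtain ⟨hev, ht1⟩ := hT₀ t ht
  have hLt := one_add_neg_log_le hd hδ hδ1 ht1
  have hLt0 : 0 < logTerm d δ t := by linarith
  set X : ℝ := 8 * 1 * R ^ 2 * logTerm d δ t / (Δ - 0) ^ 2 with hX
  have hX0 : 0 ≤ X := by positivity
  have hcard : (((Finset.range t).filter fun s => a (d + s) ≠ k ∧ T ≤ s).card : ℝ) ≤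
      2 * K * X := by
    refine card_filter_le_of_playCount_le (d := d) a _ t hX0 fun s hs hQ => ?_
    have hs1 : 1 ≤ s + 1 := by omega
    have hTs : C₁ * ((1 + -Real.log δ) * √(1 + -Real.log δ)) ≤ ((s + 1 : ℕ) : ℝ) :=
      (Nat.le_ceil _).trans (by exact_mod_cast hQ.2.trans (Nat.le_succ s))
    have c1 := (hconst _ hℓ (s + 1) hs1).1 hTs
    have hL2 : 2 * -Real.log δ + d * Real.log (1 + ((s + 1 : ℕ) : ℝ) / d) =
        2 * logTerm d δ (s + 1) := by rw [logTerm_eq hd hδ]; ring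
    rw [hL2] at c1
    refine playCount_le_of_mistake hd hbounded hforced hΔ hR hδ hδ1 ha hnoise hQ.1
      le_rfl hΔ0 le_rfl (by rw [one_mul]; exact c1) ?_ hs
    rw [add_zero]
    gcongr
  have hsplit : suboptimalPlays d k a t ≤ T + 2 * K * X := by
    rw [suboptimalPlays_eq_card]
    have hsub : ((Finset.range t).filter fun s => a (d + s) ≠ k) ⊆
        Finset.range T ∪ ((Finset.range t).filter fun s => a (d + s) ≠ k ∧ T ≤ s) := by
      intro s hs
      rw [Finset.mem_filter] at hs
      rw [Finset.mem_union, Finset.mem_filter, Finset.mem_range]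
      rcases lt_or_ge s T with h | h
      · exact Or.inl h
      · exact Or.inr ⟨hs.1, hs.2, h⟩
    have h1 := (Finset.card_le_card hsub).trans (Finset.card_union_le _ _)
    rw [Finset.card_range] at h1
    calc _ ≤ (T : ℝ) + (((Finset.range t).filter fun s => a (d + s) ≠ k ∧ T ≤ s).card : ℝ) := by
          exact_mod_cast h1
      _ ≤ _ := by gcongr
  have hXle : 2 * K * X ≤ 16 * (K + 1) * R ^ 2 / Δ ^ 2 * logTerm d δ t := by
    have : 2 * K * X = 16 * K * R ^ 2 / Δ ^ 2 * logTerm d δ t := by rw [hX, sub_zero]; ring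
    rw [this]
    gcongr
    linarith
  have hfinal : 2 * R / Δ * (√t * √(logTerm d δ t)) ≤ playBound d R δ Δ t := by
    rw [playBound_eq]
    have hD : 1 / 2 ≤ √(d * Real.log (1 + (t : ℝ) / d)) :=
      Real.le_sqrt_of_sq_le (by linarith [half_le_mul_log_one_add_div hd ht1])
    calc 2 * R / Δ * (√t * √(logTerm d δ t))
        = 4 / Δ * (√t * R * √(logTerm d δ t) * (1 / 2)) := by ring
      _ ≤ _ := by gcongr
  linarith

end PathwiseBounds

end MisspecifiedBandit

/-! ### Assembly of the two bounds. -/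

open MisspecifiedBandit in
theorem mainTheorem3 {K d : ℕ} (hd : 0 < d) (hdK : d < K)
    (Φ : Matrix (Fin K) (Fin d) ℝ)
    (hbounded : ∀ i, ‖WithLp.toLp 2 (Φ i)‖ ≤ 1)
    -- the least eigenvalue of the forced-exploration design is at least `1`
    (hforced : (forcedDesign hdK.le Φ - 1).PosSemidef)
    (μ : Fin K → ℝ) (k : Fin K)
    (hμ : μ ∈ interior (robustObservationRegion Φ k)) :
    -- the explicit bound, at all times, with a positive model-space gap `Δmin`
    -- that depends on `Φ` and `μ` only
    (∃ Δmin : ℝ, 0 < Δmin ∧ IsModelGap Φ μ k Δmin ∧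
      ∀ R : ℝ, 0 < R → ∀ δ : ℝ, 0 < δ →
        ∀ (Ω : Type*) [MeasurableSpace Ω] (P : MeasureTheory.Measure Ω)
          [MeasureTheory.IsProbabilityMeasure P] (A : ℕ → Ω → Fin K) (η : ℕ → Ω → ℝ),
          IsOFULRun hdK.le Φ μ R δ P A η →
          1 - δ ≤ P.real {ω | ∀ t : ℕ,
            suboptimalPlays d k (fun n => A n ω) t ≤ playBound d R δ Δmin t ∧
            regret d μ k (fun n => A n ω) t ≤ regretBound d R δ (maxGap μ k) Δmin t}) ∧
    -- the same bound with an arbitrary model-space gap, for all large times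
    (∀ Δ : ℝ, 0 < Δ → IsModelGap Φ μ k Δ →
      ∀ R : ℝ, 0 < R → ∀ δ : ℝ, 0 < δ → ∃ T₀ : ℕ,
        ∀ (Ω : Type*) [MeasurableSpace Ω] (P : MeasureTheory.Measure Ω)
          [MeasureTheory.IsProbabilityMeasure P] (A : ℕ → Ω → Fin K) (η : ℕ → Ω → ℝ),
          IsOFULRun hdK.le Φ μ R δ P A η →
          1 - δ ≤ P.real {ω | ∀ t : ℕ, T₀ ≤ t →
            suboptimalPlays d k (fun n => A n ω) t ≤ playBound d R δ Δ t ∧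
            regret d μ k (fun n => A n ω) t ≤ regretBound d R δ (maxGap μ k) Δ t}) := by
  constructor
  · obtain ⟨Δ, hΔ0, hΔ⟩ := exists_isModelGap (hdK := hdK) hforced hμ
    obtain ⟨Δmin, hmin0, hminle, hmain⟩ :=
      exists_gap_forall_suboptimalPlays_le hd hbounded hforced hΔ0 hΔ
    refine ⟨Δmin, hmin0, fun α hα θ hθ i hi => hminle.trans (hΔ α hα θ hθ i hi),
      fun R hR δ hδ Ω _ P _ A η hrun => ?_⟩
    -- For `δ ≥ 1` the probability bound is vacuous.
    rcases le_or_gt 1 δ with hδ1 | hδ1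
    · exact (sub_nonpos.2 hδ1).trans MeasureTheory.measureReal_nonneg
    · refine one_sub_le_measure_selfNormalized hbounded hforced hR hδ hδ1 hrun fun ω hω t => ?_
      have h := hmain R hR δ hδ hδ1 _ _ (hrun.follows ω) hω t
      exact ⟨h, regret_le_regretBound h⟩
  · intro Δ hΔ0 hΔ R hR δ hδ
    rcases le_or_gt 1 δ with hδ1 | hδ1
    · exact ⟨0, fun Ω _ P _ A η _ => (sub_nonpos.2 hδ1).trans MeasureTheory.measureReal_nonneg⟩
    · obtain ⟨T₀, hT₀⟩ :=
        exists_time_forall_suboptimalPlays_le hd hbounded hforced hΔ0 hΔ hR hδ hδ1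
      refine ⟨T₀, fun Ω _ P _ A η hrun => ?_⟩
      refine one_sub_le_measure_selfNormalized hbounded hforced hR hδ hδ1 hrun fun ω hω t ht => ?_
      have h := hT₀ _ _ (hrun.follows ω) hω t ht
      exact ⟨h, regret_le_regretBound h⟩
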